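/- Let $K$ be a number field, $S=\operatorname{Spec}\mathcal O_K$, and let $\pi:\mathcal X\to S$ be a flat quasi-projective integral scheme with smooth generic fibre $\mathcal X_K$. Let $\overline{\mathcal L}$ be a hermitian line bundle on $\mathcal X$: a line bundle $\mathcal L$ with a (continuous) hermitian metric on its complex fibres, i.e. on $\mathcal L_\sigma$ over $\mathcal X_\sigma(\mathbb C)$ for every embedding $\sigma:K\hookrightarrow\mathbb C$. Let $\overline{\mathcal F}$ be a hermitian vector bundle on $S$ with $\mathcal F\subset\pi_*\mathcal L$, i.e. a finitely generated projective $\mathcal O_K$-submodule of $H^0(\mathcal X,\mathcal L)$ with a hermitian inner product on $\mathcal F_\sigma=\mathcal F\otimes_{\mathcal O_K,\sigma}\mathbb C$ for every $\sigma$, and assume that $\mathcal L_K$ is generated over $\mathcal X_K$ by its global sections in $\mathcal F_K$. Let $P$ be a section of $\pi$; let $P_K\in\mathcal X_K(K)$ and $P_\sigma\in\mathcal X_\sigma(\mathbb C)$ be the points that it induces. Notation. * For a line bundle $\overline{\mathcal E}$ on $S$ with norms $\|\cdot\|_\sigma$, $\widehat{\deg}\,\overline{\mathcal E}=\log\#(\mathcal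 E/\mathcal O_Ks)-\sum_{\sigma}\log\|s\|_\sigma$ for any $0\ne s\in\mathcal E$, and $h_{\overline{\mathcal L}}(P)=\frac1{[K:\mathbb Q]}\widehat{\deg}\,P^*\overline{\mathcal L}$. * $\mathcal B_{\mathcal F}$ is the closed subscheme of $\mathcal X$ whose ideal sheaf $\mathcal I$ is such that $\mathcal I\cdot\mathcal L$ is the image of $\pi^*\mathcal F\to\mathcal L$. * $\mathbb P(\check{\mathcal F})$ is the projective bundle that parametrizes invertible quotients of $\mathcal F$, and $i_K:\mathcal X_K\to\mathbb P(\check{\mathcal F}_K)$ is the morphism defined by the surjection $\mathcal F_K\otimes\mathcal O_{\mathcal X_K}\to\mathcal L_K$. For $Q\in\mathbb P(\check{\mathcal F}_K)(K)$, extended to $\widetilde Q\in\mathbb P(\check{\mathcal F})(\mathcal O_K)$, $h_{\overline{\mathcal F}}(Q)=\frac1{[K:\mathbb Q]}\widehat{\deg}\,\widetilde Q^*\overline{\mathcal O(1)}$, where $\mathcal O(1)$ (the universal quotient of $\mathcal F$) has the quotient metric. * $\beta_\sigma=-\frac12\log\left(\sum_{i=1}^n\|u_i\|^2_{\overline{\mathcal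 L}_\sigma}(P_\sigma)\right)$, where $(u_i)_{1\le i\le n}$ is any orthonormal basis of $\overline{\mathcal F}_\sigma$. Then the ideal sheaf $\mathcal I$ exists, and the subscheme $P^*\mathcal B_{\mathcal F}$ of $S$ is a divisor $\sum_{\mathfrak p}\beta_{\mathfrak p}\,\mathfrak p$ over the nonzero primes of $\mathcal O_K$ (its ideal is nonzero), with integers $\beta_{\mathfrak p}\ge0$ almost all of which vanish; and, for any choice of the orthonormal bases, $$h_{\overline{\mathcal L}}(P)=h_{\overline{\mathcal F}}(i_K(P_K))+\frac1{[K:\mathbb Q]}\left(\sum_{\mathfrak p}\beta_{\mathfrak p}\log N\mathfrak p+\sum_{\sigma:K\hookrightarrow\mathbb C}\beta_\sigma\right).$$ -/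

import Mathlib

open CategoryTheory AlgebraicGeometry NumberField TensorProduct
open scoped Module.Grassmannian

noncomputable section

namespace ArakelovHeight

section Sections

/-- Global sections of a sheaf of modules on `Spec R` form an `R`-module. -/
abbrev globalModule {R : CommRingCat.{0}} (M : (Spec R).Modules) : Module R Γ(M, ⊤) :=
  inferInstance

variable {A : Type} [CommRing A]

/-- The `A`-module of global sections of a sheaf of modules on `Spec A`. -/
def GlobalSections (M : (Spec (.of A)).Modules) : Type := Γ(M, ⊤)

instance (M : (Spec (.of A)).Modules) : AddCommGroup (GlobalSections M) :=
  inferInstanceAs (AddCommGroup Γ(M, ⊤))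

instance (M : (Spec (.of A)).Modules) : Module A (GlobalSections M) :=
  globalModule (R := .of A) M

/-- The scalar action on global sections is the one through `A ≅ Γ(Spec A, ⊤)`. -/
theorem smul_globalSections (M : (Spec (.of A)).Modules) (a : A) (s : GlobalSections M) :
    a • s = ((Scheme.ΓSpecIso (.of A)).inv a • (show Γ(M, ⊤) from s) : Γ(M, ⊤)) := by
  refine (Scheme.Modules.smul_Spec_def (R := .of A) (M := M) (U := ⊤) a s).trans ?_
  congr 1

variable {X : Scheme.{0}}

/-- For a point `x ∈ X(A)`, the `A`-module `x^*L`. -/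
abbrev Fibre (L : X.Modules) (x : Spec (.of A) ⟶ X) : Type :=
  GlobalSections ((Scheme.Modules.pullback x).obj L)

/-- The pull-back `x^*s ∈ x^*L` of a section `s` of `L` on an open subset `U` through which the
point `x ∈ X(A)` factors. -/
def pullbackSection (L : X.Modules) (x : Spec (.of A) ⟶ X) (U : X.Opens) (hx : x ⁻¹ᵁ U = ⊤)
    (s : Γ(L, U)) : Fibre L x :=
  ((Scheme.Modules.pullback x).obj L).presheaf.map (eqToHom hx.symm).op
    (((Scheme.Modules.pullbackPushforwardAdjunction x).unit.app L).app U s)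

/-- The value in `A` of a function `f` on `U` at a point of `U(A)`. -/
def evalFunction (x : Spec (.of A) ⟶ X) (U : X.Opens) (hx : x ⁻¹ᵁ U = ⊤) (f : Γ(X, U)) : A :=
  (Scheme.ΓSpecIso (.of A)).hom
    ((Spec (.of A)).presheaf.map (eqToHom hx.symm).op (x.app U f))

/-- For `x ∈ X(A)` and a ring homomorphism `φ : A → B`, the restriction map from `x^*L` to the fibre
of `L` at the induced point of `X(B)`. -/
def restrictFibre {B : Type} [CommRing B] (L : X.Modules) (x : Spec (.of A) ⟶ X) (φ : A →+* B)
    (s : Fibre L x) : Fibre L (Spec.map (CommRingCat.ofHom φ) ≫ x) :=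
  ((Scheme.Modules.pullbackComp (Spec.map (CommRingCat.ofHom φ)) x).hom.app L).app ⊤
    (pullbackSection ((Scheme.Modules.pullback x).obj L) (Spec.map (CommRingCat.ofHom φ)) ⊤ rfl s)

end Sections

section Relative

variable {R A : Type} [CommRing R] [CommRing A] [Algebra R A] {X : Scheme.{0}}

/-- `Γ(X, L)`, as the `R`-module of global sections of `π_*L`, for `π : X ⟶ Spec R`. -/
abbrev DirectImage (π : X ⟶ Spec (.of R)) (L : X.Modules) : Type :=
  GlobalSections ((Scheme.Modules.pushforward π).obj L)

theorem pullbackSection_smul (π : X ⟶ Spec (.of R)) (L : X.Modules) (x : Spec (.of A) ⟶ X)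
    (hx : x ≫ π = Spec.map (CommRingCat.ofHom (algebraMap R A))) (r : R) (s : DirectImage π L) :
    pullbackSection L x ⊤ rfl (r • s : DirectImage π L) =
      (algebraMap R A r) • pullbackSection L x ⊤ rfl s := by
  let t : Γ(X, ⊤) := π.app ⊤ ((Scheme.ΓSpecIso (.of R)).inv r)
  have h1 : (r • s : DirectImage π L) = (t • (show Γ(L, ⊤) from s) : Γ(L, ⊤)) :=
    smul_globalSections _ r s
  have h2 : x.app ⊤ t = (Scheme.ΓSpecIso (.of A)).inv (algebraMap R A r) := by
    have h3 := congr($(Scheme.ΓSpecIso_inv_naturality (CommRingCat.ofHom (algebraMap R A))) r)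
    refine Eq.trans ?_ h3.symm
    have h4 := congr(Scheme.Hom.appTop $hx)
    have h5 := congr($h4 ((Scheme.ΓSpecIso (.of R)).inv r))
    exact h5
  rw [h1, smul_globalSections, ← h2]
  unfold pullbackSection
  erw [Scheme.Modules.Hom.app_smul]
  exact Scheme.Modules.map_smul _ _ _ _

theorem pullbackSection_add (L : X.Modules) (x : Spec (.of A) ⟶ X) (s t : Γ(L, ⊤)) :
    pullbackSection L x ⊤ rfl (s + t) =
      pullbackSection L x ⊤ rfl s + pullbackSection L x ⊤ rfl t := by
  unfold pullbackSection
  rw [map_add]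
  exact map_add _ _ _

/-- For an `R`-submodule `F` of `Γ(X, L)` and a point `x ∈ X(A)` over `R`, the evaluation map
`A ⊗ F ⟶ x^*L`, `a ⊗ s ↦ a • x^*s`. -/
def evaluation (π : X ⟶ Spec (.of R)) (L : X.Modules) (F : Submodule R (DirectImage π L))
    (x : Spec (.of A) ⟶ X) (hx : x ≫ π = Spec.map (CommRingCat.ofHom (algebraMap R A))) :
    A ⊗[R] F →ₗ[A] Fibre L x :=
  letI : Module R (Fibre L x) := Module.compHom _ (algebraMap R A)
  haveI : IsScalarTower R A (Fibre L x) := IsScalarTower.of_algebraMap_smul fun _ _ => rfl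
  LinearMap.liftBaseChange A
    { toFun := fun s => pullbackSection L x ⊤ rfl (s : DirectImage π L)
      map_add' := fun s t => pullbackSection_add L x (s : DirectImage π L) (t : DirectImage π L)
      map_smul' := fun r s => pullbackSection_smul π L x hx r s }

end Relative

section Geometry

attribute [local instance] MvPolynomial.gradedAlgebra

/-- `X` is quasi-projective over `Spec R`: it admits an immersion over `Spec R` into some
projective space `ℙⁿ` over `R`. -/
def IsQuasiProjective {R : Type} [CommRing R] {X : Scheme.{0}} (π : X ⟶ Spec (.of R)) : Prop :=
  ∃ (n : ℕ) (i : X ⟶ Proj (MvPolynomial.homogeneousSubmodule (Fin (n + 1)) R)), IsImmersion i ∧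
    i ≫ Proj.toSpecZero (MvPolynomial.homogeneousSubmodule (Fin (n + 1)) R) ≫
      Spec.map (CommRingCat.ofHom
        (algebraMap R (MvPolynomial.homogeneousSubmodule (Fin (n + 1)) R 0))) = π

variable {X : Scheme.{0}}

/-- `L` is a line bundle on `X`: it is locally isomorphic to the structure sheaf. -/
def IsLineBundle (L : X.Modules) : Prop :=
  ∀ x : X, ∃ U : X.Opens, x ∈ U ∧
    Nonempty (L.restrict U.ι ≅ (SheafOfModules.unit U.toScheme.ringCatSheaf : U.toScheme.Modules))

/-- The set of complex points `X(ℂ)`. For `X` over `𝓞 K` it is the disjoint union of the sets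
`X_σ(ℂ)`, for `σ : K → ℂ`. -/
abbrev ComplexPoints (X : Scheme.{0}) : Type := Spec (.of ℂ) ⟶ X

/-- The classical topology on `X(ℂ)`, generated by the sets `{x ∈ U(ℂ) | f(x) ∈ W}` for `U` open
in `X`, `f` a function on `U`, and `W` open in `ℂ`. -/
@[reducible]
def classicalTopology (X : Scheme.{0}) : TopologicalSpace (ComplexPoints X) :=
  TopologicalSpace.generateFrom
    {S | ∃ (U : X.Opens) (f : Γ(X, U)) (W : Set ℂ), IsOpen W ∧
      S = {x | ∃ hx : x ⁻¹ᵁ U = ⊤, evalFunction x U hx f ∈ W}}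

/-- The norm of a hermitian inner product. -/
def hermNorm {V : Type} [AddCommGroup V] [Module ℂ V] (c : InnerProductSpace.Core ℂ V) (v : V) : ℝ :=
  √(c.inner v v).re

/-- A (continuous) hermitian metric on `L`: a hermitian inner product on each complex fibre, such
that the norm of any section of `L` on any open subset `U` is continuous on `U(ℂ)`. -/
structure HermitianMetric (L : X.Modules) where
  inner : ∀ x : ComplexPoints X, InnerProductSpace.Core ℂ (Fibre L x)
  continuous_norm : ∀ (U : X.Opens) (s : Γ(L, U)),
    @Continuous _ _ ((classicalTopology X).induced Subtype.val) inferInstance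
      fun x : {x : ComplexPoints X // x ⁻¹ᵁ U = ⊤} =>
        hermNorm (inner x.1) (pullbackSection L x.1 U x.2 s)

end Geometry

section BasePoints

variable {R : Type} [CommRing R] {X : Scheme.{0}} (π : X ⟶ Spec (.of R)) (L : X.Modules)
  (F : Submodule R (DirectImage π L))

/-- The sections on `U` generated by `F`; for affine `U`, these are the sections on `U` of the image
of `π^*F ⟶ L`. -/
def generatedSections (U : X.Opens) : Submodule Γ(X, U) Γ(L, U) :=
  Submodule.span Γ(X, U)
    {t | ∃ s : DirectImage π L, s ∈ F ∧ t = L.presheaf.map (homOfLE le_top : U ⟶ ⊤).op s}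

/-- `F` generates `L` at the point `x`: the map `π^*F ⟶ L` is surjective on stalks at `x`. -/
def GeneratesAt (x : X) : Prop :=
  ∀ (U : X.Opens), x ∈ U → ∀ t : Γ(L, U), ∃ (V : X.Opens) (hVU : V ≤ U), x ∈ V ∧
    L.presheaf.map (homOfLE hVU).op t ∈ generatedSections π L F V

/-- The ideal sheaf of the subscheme of base points of `F`: the largest (quasi-coherent) ideal sheaf
`I` such that `I · L` is contained in the image of `π^*F ⟶ L`. -/
def baseIdeal : X.IdealSheafData :=
  sSup {I | ∀ U : X.affineOpens,
    I.ideal U • (⊤ : Submodule Γ(X, U) Γ(L, U)) ≤ generatedSections π L F U}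

/-- The ideal of `R` defining the closed subscheme `P^*Z` of `Spec R`, where `Z` is the closed
subscheme of `X` with ideal sheaf `I`. -/
def pullbackIdeal (I : X.IdealSheafData) (P : Spec (.of R) ⟶ X) : Ideal R :=
  Ideal.comap (Scheme.ΓSpecIso (.of R)).inv.hom ((I.comap P).ideal ⟨⊤, isAffineOpen_top _⟩)

/-- The multiplicity `β_𝔭` at `𝔭` of the pull-back by `P` of the subscheme of base points. -/
def finiteMultiplicity (P : Spec (.of R) ⟶ X) (p : IsDedekindDomain.HeightOneSpectrum R) : ℕ :=
  multiplicity p.asIdeal (pullbackIdeal (baseIdeal π L F) P)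

end BasePoints

section Arakelov

variable {K : Type} [Field K] [NumberField K]

/-- The embedding `σ`, restricted to the ring of integers. -/
abbrev intEmbedding (σ : K →+* ℂ) : 𝓞 K →+* ℂ := σ.comp (algebraMap (𝓞 K) K)

/-- `M_σ = ℂ ⊗ M`, where `ℂ` is an `𝓞 K`-algebra by means of `σ`. -/
def Complexification (σ : K →+* ℂ) (M : Type) [AddCommGroup M] [Module (𝓞 K) M] : Type :=
  letI : Algebra (𝓞 K) ℂ := (intEmbedding σ).toAlgebra
  ℂ ⊗[𝓞 K] M

variable (σ : K →+* ℂ) (M N : Type) [AddCommGroup M] [Module (𝓞 K) M]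
  [AddCommGroup N] [Module (𝓞 K) N]

instance : AddCommGroup (Complexification σ M) :=
  letI : Algebra (𝓞 K) ℂ := (intEmbedding σ).toAlgebra
  (TensorProduct.addCommGroup : AddCommGroup (ℂ ⊗[𝓞 K] M))

instance : Module ℂ (Complexification σ M) :=
  letI : Algebra (𝓞 K) ℂ := (intEmbedding σ).toAlgebra
  (TensorProduct.leftModule : Module ℂ (ℂ ⊗[𝓞 K] M))

variable {M N}

/-- The element `1 ⊗ m` of `M_σ`. -/
def toComplexification (m : M) : Complexification σ M :=
  letI : Algebra (𝓞 K) ℂ := (intEmbedding σ).toAlgebra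
  (1 : ℂ) ⊗ₜ[𝓞 K] m

/-- The map `M_σ ⟶ N_σ` induced by `f : M ⟶ N`. -/
def complexifyMap (f : M →ₗ[𝓞 K] N) : Complexification σ M →ₗ[ℂ] Complexification σ N :=
  letI : Algebra (𝓞 K) ℂ := (intEmbedding σ).toAlgebra
  f.baseChange ℂ

variable (K M) in
/-- A hermitian structure on the vector bundle on `Spec (𝓞 K)` given by the module `M`: a hermitian
inner product on `M_σ` for every embedding `σ`. -/
abbrev HermitianStructure : Type :=
  ∀ σ : K →+* ℂ, InnerProductSpace.Core ℂ (Complexification σ M)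

open Classical in
variable (K M) in
/-- The Arakelov degree of a line bundle on `Spec (𝓞 K)` given by the module `M`, with norms
`‖·‖_σ`: it is `log #(M / 𝓞 K s) - ∑ log ‖s‖_σ` for a nonzero `s` in `M`, which is chosen here (by the product
formula the value does not depend on `s`). -/
def arakelovDegree (nrm : (K →+* ℂ) → M → ℝ) : ℝ :=
  if h : ∃ s : M, s ≠ 0 then
    Real.log (Nat.card (M ⧸ Submodule.span (𝓞 K) {h.choose})) - ∑ σ, Real.log (nrm σ h.choose)
  else 0

/-- The complex point `P_σ` induced by `P ∈ X(𝓞 K)` and the embedding `σ`. -/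
abbrev complexPoint {X : Scheme.{0}} (P : Spec (.of (𝓞 K)) ⟶ X) (σ : K →+* ℂ) : ComplexPoints X :=
  Spec.map (CommRingCat.ofHom (intEmbedding σ)) ≫ P

/-- The height `[K : ℚ]⁻¹ deg(P^*L)` of `P ∈ X(𝓞 K)` with respect to a hermitian line bundle. -/
def sectionHeight {X : Scheme.{0}} (L : X.Modules) (g : HermitianMetric L)
    (P : Spec (.of (𝓞 K)) ⟶ X) : ℝ :=
  (Module.finrank ℚ K : ℝ)⁻¹ * arakelovDegree K (Fibre L P) fun σ s =>
    hermNorm (g.inner (complexPoint P σ)) (restrictFibre L P (intEmbedding σ) s)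

/-- The evaluation `F_σ ⟶ L_{P_σ}` at the complex point `P_σ` of a section `P`. -/
def complexEvaluation {X : Scheme.{0}} (π : X ⟶ Spec (.of (𝓞 K))) (L : X.Modules)
    (F : Submodule (𝓞 K) (DirectImage π L)) (P : Spec (.of (𝓞 K)) ⟶ X) (hP : P ≫ π = 𝟙 _)
    (σ : K →+* ℂ) : Complexification σ F →ₗ[ℂ] Fibre L (complexPoint P σ) :=
  letI : Algebra (𝓞 K) ℂ := (intEmbedding σ).toAlgebra
  evaluation π L F (complexPoint P σ) (by rw [Category.assoc, hP, Category.comp_id])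

/-- The archimedean term `β_σ = -1/2 log ∑ ‖u_i‖²(P_σ)` for a family `u` of elements of `F_σ`. -/
def archimedeanTerm {X : Scheme.{0}} (π : X ⟶ Spec (.of (𝓞 K))) (L : X.Modules)
    (g : HermitianMetric L) (F : Submodule (𝓞 K) (DirectImage π L)) (P : Spec (.of (𝓞 K)) ⟶ X)
    (hP : P ≫ π = 𝟙 _) (σ : K →+* ℂ) {n : ℕ} (u : Fin n → Complexification σ F) : ℝ :=
  -(1 / 2) * Real.log (∑ i, hermNorm (g.inner (complexPoint P σ))
    (complexEvaluation π L F P hP σ (u i)) ^ 2)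

/-- The `K`-point `P_K` of `X` given by the restriction of `P ∈ X(𝓞 K)` to `Spec K`. -/
abbrev genericPoint {X : Scheme.{0}} (P : Spec (.of (𝓞 K)) ⟶ X) : Spec (.of K) ⟶ X :=
  Spec.map (CommRingCat.ofHom (algebraMap (𝓞 K) K)) ≫ P

/-- The evaluation `K ⊗ F ⟶ L_{P_K}` at `P_K`. When it is surjective, the one-dimensional quotient
of `K ⊗ F` that it defines is the image of `P_K` under the morphism from `X_K` to the projective
bundle of `K ⊗ F` defined by the sections in `F`. -/
def genericEvaluation {X : Scheme.{0}} (π : X ⟶ Spec (.of (𝓞 K))) (L : X.Modules)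
    (F : Submodule (𝓞 K) (DirectImage π L)) (P : Spec (.of (𝓞 K)) ⟶ X) (hP : P ≫ π = 𝟙 _) :
    K ⊗[𝓞 K] F →ₗ[K] Fibre L (genericPoint P) :=
  evaluation π L F (genericPoint P) (by rw [Category.assoc, hP, Category.comp_id])

end Arakelov

section Projective

variable {K : Type} [Field K] [NumberField K] (E : Type) [AddCommGroup E] [Module (𝓞 K) E]

/-- The elements of `E` whose image in `K ⊗ E` lies in `Q`. -/
def latticeKernel (Q : Submodule K (K ⊗[𝓞 K] E)) : Submodule (𝓞 K) E :=
  (Q.restrictScalars (𝓞 K)).comap (TensorProduct.mk (𝓞 K) K E 1)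

/-- The injection of the image of `E` in the quotient `(K ⊗ E) ⧸ Q`. -/
def latticeMap (Q : Submodule K (K ⊗[𝓞 K] E)) :
    (E ⧸ latticeKernel E Q) →ₗ[𝓞 K] ((K ⊗[𝓞 K] E) ⧸ Q) :=
  (latticeKernel E Q).liftQ ((Q.mkQ.restrictScalars (𝓞 K)) ∘ₗ TensorProduct.mk (𝓞 K) K E 1)
    (fun v hv => by simpa [latticeKernel] using hv)

theorem latticeMap_injective (Q : Submodule K (K ⊗[𝓞 K] E)) :
    Function.Injective (latticeMap E Q) := by
  rw [← LinearMap.ker_eq_bot]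
  apply Submodule.ker_liftQ_eq_bot
  intro v hv
  simpa [latticeKernel] using hv

instance (Q : Submodule K (K ⊗[𝓞 K] E)) :
    IsLocalizedModule (nonZeroDivisors (𝓞 K)) (latticeMap E Q) where
  map_units r := by
    rw [Module.End.isUnit_iff]
    have hr : (algebraMap (𝓞 K) K r) ≠ 0 := by
      simp
    constructor
    · intro a b hab
      have h : (algebraMap (𝓞 K) K r) • a = (algebraMap (𝓞 K) K r) • b := by
        simpa [algebraMap_smul] using hab
      exact smul_right_injective _ hr h
    · intro a
      refine ⟨(algebraMap (𝓞 K) K r)⁻¹ • a, ?_⟩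
      change (r : 𝓞 K) • ((algebraMap (𝓞 K) K r)⁻¹ • a) = a
      rw [← algebraMap_smul K (r : 𝓞 K), smul_inv_smul₀ hr]
  surj y := by
    obtain ⟨z, rfl⟩ := Q.mkQ_surjective y
    obtain ⟨⟨e, s⟩, h⟩ := IsLocalizedModule.surj (nonZeroDivisors (𝓞 K))
      (TensorProduct.mk (𝓞 K) K E 1) z
    refine ⟨⟨Submodule.Quotient.mk e, s⟩, ?_⟩
    have := congr(Q.mkQ $h)
    exact this
  exists_of_eq {a b} h := ⟨1, by rw [latticeMap_injective E Q h]⟩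

/-- A `K`-point of the projective bundle of one-dimensional quotients of `E` extends uniquely to an
`𝓞 K`-point: if the former is the quotient `(K ⊗ E) ⧸ Q`, the latter is the image of `E` in it. -/
def integralPoint [Module.Finite (𝓞 K) E] (Q : G(1, K ⊗[𝓞 K] E; K)) : G(1, E; 𝓞 K) :=
  have hfl : Module.Flat (𝓞 K) (E ⧸ latticeKernel E Q.toSubmodule) := by
    rw [IsDedekindDomain.flat_iff_torsion_eq_bot, eq_bot_iff]
    rintro v ⟨r, hr⟩
    have hr0 : (algebraMap (𝓞 K) K r) ≠ 0 := by simp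
    have h : (algebraMap (𝓞 K) K r) • latticeMap E Q.toSubmodule v = 0 := by
      rw [algebraMap_smul, ← map_smul]
      have : (r : 𝓞 K) • v = 0 := hr
      rw [this, map_zero]
    have h2 := (smul_eq_zero_iff_right hr0).1 h
    exact latticeMap_injective E _ (by rw [h2, map_zero])
  { toSubmodule := latticeKernel E Q.toSubmodule
    finite_quotient := inferInstance
    projective_quotient := by
      have : Module.FinitePresentation (𝓞 K) (E ⧸ latticeKernel E Q.toSubmodule) :=
        Module.finitePresentation_of_finite _ _
      exact Module.Flat.projective_of_finitePresentation
    rankAtStalk_eq := fun p => by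
      have hb : IsBaseChange K (latticeMap E Q.toSubmodule) :=
        (isLocalizedModule_iff_isBaseChange (nonZeroDivisors (𝓞 K)) K _).1 inferInstance
      have h := Module.rankAtStalk_isBaseChange hb ⊥
      rw [Q.rankAtStalk_eq] at h
      refine Eq.trans (Module.rankAtStalk_eq_of_le_of_finite_of_flat _ ?_).symm h.symm
      intro a ha
      have : algebraMap (𝓞 K) K a = 0 := ha
      have : a = 0 := by simpa using this
      rw [this]; exact zero_mem _ }

/-- The quotient norms on `E ⧸ N`: the norm of `v` at `σ` is the infimum of the norms of the elements
of `E_σ` that lift the image of `v` in `(E ⧸ N)_σ`. -/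
def quotientNorm (h : HermitianStructure K E) (N : Submodule (𝓞 K) E) (σ : K →+* ℂ) (v : E ⧸ N) : ℝ :=
  sInf {r | ∃ w : Complexification σ E,
    complexifyMap σ N.mkQ w = toComplexification σ v ∧ r = hermNorm (h σ) w}

/-- The height of a `K`-point of the projective bundle of one-dimensional quotients of `E`, with
respect to the line bundle `O(1)` with the metric defined by the hermitian structure of `E` as a
quotient of the pull-back of `E`: the fibre of `O(1)` at the `𝓞 K`-point extending `Q` is
the corresponding quotient of `E`. -/
def projectiveHeight [Module.Finite (𝓞 K) E] (h : HermitianStructure K E)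
    (Q : G(1, K ⊗[𝓞 K] E; K)) : ℝ :=
  (Module.finrank ℚ K : ℝ)⁻¹ * arakelovDegree K (E ⧸ (integralPoint E Q).toSubmodule)
    (quotientNorm E h (integralPoint E Q).toSubmodule)

end Projective

end ArakelovHeight

end

/-! Write M = P^*L, a torsion-free module of rank one over `𝓞 K`, and let ev : F → M be s ↦ P^*s.
Everything reduces to comparing M with the quotient F/ker ev.

Geometry. On an affine open U the colon ideal (G : L(U)), with G the sections generated by F,
commutes with localization because L(U) is finitely generated, and its product with L(U) is G
because L(U) is locally cyclic. These colon ideals thus form the ideal sheaf sought, which yields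
`baseIdeal_smul_top`. The equality I · L = image of π^*F survives pull-back along P
(`pulledSections_eq`), so the image of ev is J · M, where J is the ideal of P^*B_F
(`range_sectionEvaluation`). As F generates L over the generic fibre, ev and J are nonzero. The
pull-back of modules is only given as a left adjoint, so its explicit description starts from
`IsGenerator.pullback`: local bases pull back to local bases.

Arithmetic. Elements of M are detected at P_K, so ker ev is the set of s in F that vanish at P_K.
Hence F/ker ev is the fibre of O(1) at the integral point extending i_K(P_K)
(`latticeKernel_ker_genericEvaluation`). Embed M in `𝓞 K` by some φ. A norm on M has the form |σ(φ
m)| c_σ, and the degree is then -log N(φ M) - ∑ log c_σ (`arakelovDegree_eq`, by the product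
formula). Passing from M to F/ker ev ≅ J · M replaces φ M by J · φ M, which gives the finite terms.
By Cauchy–Schwarz, the quotient norm is the norm of M divided by (∑ ‖u_i‖²(P_σ))^{1/2}
(`isLeast_norm_lift`, `quotientNorm_eq`), which gives the archimedean terms. The two degrees are
compared in `arakelovDegree_eq_add`. -/

open CategoryTheory AlgebraicGeometry NumberField TensorProduct
open scoped Module.Grassmannian

noncomputable section

namespace ArakelovHeight

/-! ### Colon ideals, localization and locally cyclic modules. -/

section LocalAlgebra

variable {R R' M M' : Type*} [CommRing R] [CommRing R'] [AddCommGroup M] [AddCommGroup M']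
  [Module R M] [Module R' M'] {ρ : R →+* R'}

/-- The semilinear map `r : M → M'` exhibits `M'` as the localization of `M` away from `f`. -/
structure LocalizesAt (f : R) (ρ : R →+* R') (r : M →ₛₗ[ρ] M') : Prop where
  isUnit : IsUnit (ρ f)
  surj : ∀ m' : M', ∃ (n : ℕ) (m : M), r m = ρ f ^ n • m'
  eq_zero : ∀ m : M, r m = 0 → ∃ n : ℕ, f ^ n • m = 0
  ring_surj : ∀ b : R', ∃ (n : ℕ) (a : R), ρ a = ρ f ^ n * b

namespace LocalizesAt

variable {f : R} {r : M →ₛₗ[ρ] M'}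

theorem exists_smul_eq (hr : LocalizesAt f ρ r) {m₁ m₂ : M} (h : r m₁ = r m₂) :
    ∃ n : ℕ, f ^ n • m₁ = f ^ n • m₂ := by
  obtain ⟨n, hn⟩ := hr.eq_zero (m₁ - m₂) (by rw [map_sub, h, sub_self])
  exact ⟨n, by rwa [smul_sub, sub_eq_zero] at hn⟩

/-- Denominators are cleared along the linear combination: `ring_surj` treats the coefficients, and
a sum is brought to a common power of f. -/
theorem exists_mem_of_mem_span (hr : LocalizesAt f ρ r) {N : Submodule R M} {m' : M'}
    (h : m' ∈ Submodule.span R' (r '' N)) : ∃ (n : ℕ), ∃ x ∈ N, r x = ρ f ^ n • m' := by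
  induction h using Submodule.span_induction with
  | mem x hx =>
    obtain ⟨y, hy, rfl⟩ := hx
    exact ⟨0, y, hy, by simp⟩
  | zero => exact ⟨0, 0, N.zero_mem, by simp⟩
  | add x y _ _ hx hy =>
    obtain ⟨n₁, x₁, h₁, e₁⟩ := hx
    obtain ⟨n₂, x₂, h₂, e₂⟩ := hy
    refine ⟨n₁ + n₂, f ^ n₂ • x₁ + f ^ n₁ • x₂,
      N.add_mem (N.smul_mem _ h₁) (N.smul_mem _ h₂), ?_⟩
    rw [map_add, map_smulₛₗ, map_smulₛₗ, e₁, e₂, map_pow, map_pow, smul_add, smul_smul, smul_smul,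
      ← pow_add, ← pow_add, add_comm n₂]
  | smul a x _ hx =>
    obtain ⟨n, y, hy, e⟩ := hx
    obtain ⟨k, b, hb⟩ := hr.ring_surj a
    refine ⟨k + n, b • y, N.smul_mem _ hy, ?_⟩
    rw [map_smulₛₗ, hb, e, smul_smul, smul_smul]
    congr 1
    ring

theorem mem_span_of_exists (hr : LocalizesAt f ρ r) {N : Submodule R M} {m' : M'}
    {n : ℕ} {x : M} (hx : x ∈ N) (h : r x = ρ f ^ n • m') : m' ∈ Submodule.span R' (r '' N) := by
  obtain ⟨u, hu⟩ := hr.isUnit.pow n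
  have : m' = (↑u⁻¹ : R') • r x := by rw [h, ← hu, smul_smul, Units.inv_mul, one_smul]
  rw [this]
  exact Submodule.smul_mem _ _ (Submodule.subset_span ⟨x, hx, rfl⟩)

theorem exists_smul_mem (hr : LocalizesAt f ρ r) {N : Submodule R M} {m : M}
    (h : r m ∈ Submodule.span R' (r '' N)) : ∃ n : ℕ, f ^ n • m ∈ N := by
  obtain ⟨n, x, hx, e⟩ := hr.exists_mem_of_mem_span h
  obtain ⟨k, hk⟩ := hr.exists_smul_eq (m₁ := x) (m₂ := f ^ n • m)
    (by rw [map_smulₛₗ, map_pow, e])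
  refine ⟨k + n, ?_⟩
  rw [pow_add, mul_smul, ← hk]
  exact N.smul_mem _ hx

theorem span_image_top (hr : LocalizesAt f ρ r) :
    Submodule.span R' (r '' (⊤ : Submodule R M)) = ⊤ := by
  rw [eq_top_iff]
  rintro m' -
  obtain ⟨n, m, h⟩ := hr.surj m'
  exact hr.mem_span_of_exists Submodule.mem_top h

end LocalizesAt

/-- The elements of `R` that multiply `M` into `G`. -/
def colonIdeal (G : Submodule R M) : Ideal R where
  carrier := {a | ∀ m : M, a • m ∈ G}
  add_mem' ha hb m := by rw [add_smul]; exact G.add_mem (ha m) (hb m)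
  zero_mem' m := by rw [zero_smul]; exact G.zero_mem
  smul_mem' c a ha m := by rw [smul_eq_mul, mul_smul]; exact G.smul_mem _ (ha m)

theorem le_colonIdeal_iff {G : Submodule R M} {I : Ideal R} :
    I ≤ colonIdeal G ↔ I • (⊤ : Submodule R M) ≤ G := by
  rw [Submodule.smul_le]
  exact ⟨fun h a ha m _ => h ha m, fun h a ha m => h a ha m Submodule.mem_top⟩

/-- For finitely generated `M`, a uniform power of `f` suffices to multiply `M` into `G`. -/
theorem exists_pow_mul_mem_colonIdeal [Module.Finite R M] {G : Submodule R M} {a f : R}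
    (h : ∀ m : M, ∃ n : ℕ, (f ^ n * a) • m ∈ G) : ∃ n : ℕ, f ^ n * a ∈ colonIdeal G := by
  obtain ⟨S, hS⟩ := Module.Finite.fg_top (R := R) (M := M)
  choose n hn using h
  refine ⟨S.sup n, fun m => ?_⟩
  have hm : m ∈ Submodule.span R (S : Set M) := hS ▸ Submodule.mem_top
  induction hm using Submodule.span_induction with
  | mem x hx =>
    obtain ⟨k, hk⟩ := Nat.exists_eq_add_of_le (Finset.le_sup (f := n) hx)
    rw [hk, add_comm, pow_add, mul_assoc, mul_smul]
    exact G.smul_mem _ (hn x)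
  | zero => rw [smul_zero]; exact G.zero_mem
  | add x y _ _ hx hy => rw [smul_add]; exact G.add_mem hx hy
  | smul c x _ hx => rw [smul_comm]; exact G.smul_mem _ hx

/-- For each m some power of f works; finite generation of M makes the exponent uniform. This is
what makes U ↦ (G(U) : L(U)) quasi-coherent. -/
theorem LocalizesAt.map_colonIdeal [Module.Finite R M] {f : R} {r : M →ₛₗ[ρ] M'}
    (hr : LocalizesAt f ρ r) (G : Submodule R M) :
    (colonIdeal G).map ρ = colonIdeal (Submodule.span R' (r '' G)) := by
  apply le_antisymm
  · rw [Ideal.map_le_iff_le_comap]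
    intro a ha m'
    obtain ⟨n, m, h⟩ := hr.surj m'
    refine hr.mem_span_of_exists (n := n) (ha m) ?_
    rw [map_smulₛₗ, h, smul_comm]
  · intro b hb
    obtain ⟨n, a, ha⟩ := hr.ring_surj b
    obtain ⟨k, hk⟩ := exists_pow_mul_mem_colonIdeal (G := G) (a := a) (f := f) fun m => by
      have h : r (a • m) ∈ Submodule.span R' (r '' G) := by
        rw [map_smulₛₗ, ha, mul_smul]
        exact Submodule.smul_mem _ _ (hb _)
      obtain ⟨j, hj⟩ := hr.exists_smul_mem h
      exact ⟨j, by rwa [mul_smul]⟩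
    obtain ⟨u, hu⟩ := hr.isUnit.pow (k + n)
    have h : b = (↑u⁻¹ : R') * ρ (f ^ k * a) := by
      rw [map_mul, map_pow, ha, ← mul_assoc (ρ f ^ k), ← pow_add, ← hu, Units.inv_mul_cancel_left]
    rw [h]
    exact Ideal.mul_mem_left _ _ (Ideal.mem_map_of_mem _ hk)

/-- A module is locally cyclic if it becomes cyclic after localization away from each element of
a finite set that generates the unit ideal. -/
structure LocallyCyclic (R M : Type*) [CommRing R] [AddCommGroup M] [Module R M] : Prop where
  exists_span : ∃ s : Finset R, Ideal.span (s : Set R) = ⊤ ∧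
    ∀ f ∈ s, ∃ t : M, ∀ m : M, ∃ (k : ℕ) (a : R), f ^ k • m = a • t

theorem LocallyCyclic.finite (h : LocallyCyclic R M) : Module.Finite R M := by
  classical
  obtain ⟨s, hs, H⟩ := h.exists_span
  choose! t ht using H
  refine ⟨⟨s.image t, ?_⟩⟩
  rw [eq_top_iff]
  rintro m -
  refine Submodule.mem_of_span_eq_top_of_smul_pow_mem _ _ hs _ fun f => ?_
  obtain ⟨k, a, e⟩ := ht f f.2 m
  refine ⟨k, ?_⟩
  rw [e]
  exact Submodule.smul_mem _ _ (Submodule.subset_span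
    (Finset.mem_coe.2 (Finset.mem_image_of_mem t f.2)))

/-- If t generates M up to powers of f and f^k g = a t with g in G, then a m is, up to powers of f,
a multiple of a t, so it falls in G. Hence some f^n a lies in the colon ideal, and f^(n+k) g = (f^n
a) t. The elements f generate the unit ideal, so g itself lies in the product. -/
theorem LocallyCyclic.colonIdeal_smul_top (h : LocallyCyclic R M) (G : Submodule R M) :
    colonIdeal G • (⊤ : Submodule R M) = G := by
  have := h.finite
  apply le_antisymm (le_colonIdeal_iff.1 le_rfl)
  obtain ⟨s, hs, H⟩ := h.exists_span
  intro g hg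
  refine Submodule.mem_of_span_eq_top_of_smul_pow_mem _ _ hs _ fun f => ?_
  obtain ⟨t, ht⟩ := H f f.2
  obtain ⟨k, a, e⟩ := ht g
  obtain ⟨n, hn⟩ := exists_pow_mul_mem_colonIdeal (G := G) (a := a) (f := (f : R)) fun m => by
    obtain ⟨j, b, hb⟩ := ht m
    refine ⟨j, ?_⟩
    rw [mul_comm, mul_smul, hb, smul_comm, ← e]
    exact G.smul_mem _ (G.smul_mem _ hg)
  refine ⟨n + k, ?_⟩
  rw [pow_add, mul_smul, e, ← mul_smul]
  exact Submodule.smul_mem_smul hn Submodule.mem_top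

end LocalAlgebra

/-! ### Restriction maps, gluing and local bases of a sheaf of modules. -/

section Restriction

variable {X : Scheme.{0}}

/-- Restriction of functions. -/
abbrev resRing {U V : X.Opens} (h : V ≤ U) : Γ(X, U) →+* Γ(X, V) :=
  (X.presheaf.map (homOfLE h).op).hom

/-- Restriction of sections of a sheaf of modules, as a semilinear map. -/
def res (L : X.Modules) {U V : X.Opens} (h : V ≤ U) : Γ(L, U) →ₛₗ[resRing h] Γ(L, V) where
  toFun s := L.presheaf.map (homOfLE h).op s
  map_add' := map_add _
  map_smul' a s := Scheme.Modules.map_smul L (homOfLE h) a s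

variable {L : X.Modules} {U V W : X.Opens}

theorem res_apply (h : V ≤ U) (s : Γ(L, U)) : res L h s = L.presheaf.map (homOfLE h).op s := rfl

@[simp]
theorem res_res (h : V ≤ U) (h' : W ≤ V) (s : Γ(L, U)) :
    res L h' (res L h s) = res L (h'.trans h) s := by
  simp only [res_apply]
  rw [← ConcreteCategory.comp_apply, ← Functor.map_comp]
  rfl

@[simp]
theorem res_self (s : Γ(L, U)) : res L le_rfl s = s := by
  have : (homOfLE (le_refl U)).op = 𝟙 _ := rfl
  rw [res_apply, this, L.presheaf.map_id]
  rfl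

@[simp]
theorem resRing_resRing (h : V ≤ U) (h' : W ≤ V) (s : Γ(X, U)) :
    resRing h' (resRing h s) = resRing (h'.trans h) s := by
  rw [← RingHom.comp_apply, ← CommRingCat.hom_comp, ← Functor.map_comp]
  rfl

@[simp]
theorem resRing_self (s : Γ(X, U)) : resRing le_rfl s = s := by
  change (X.presheaf.map (𝟙 _)).hom s = s
  rw [X.presheaf.map_id]
  rfl

theorem res_smul (h : V ≤ U) (a : Γ(X, U)) (s : Γ(L, U)) :
    res L h (a • s) = resRing h a • res L h s := map_smulₛₗ _ _ _

theorem res_ext {ι : Type*} (V : ι → X.Opens) (hV : ∀ i, V i ≤ U) (hU : U ≤ ⨆ i, V i)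
    {s t : Γ(L, U)} (h : ∀ i, res L (hV i) s = res L (hV i) t) : s = t :=
  TopCat.Sheaf.eq_of_locally_eq' ⟨_, L.isSheaf⟩ V U (fun i => homOfLE (hV i)) hU s t h

theorem exists_glue {ι : Type*} (V : ι → X.Opens) (hV : ∀ i, V i ≤ U) (hU : U ≤ ⨆ i, V i)
    (s : ∀ i, Γ(L, V i))
    (h : ∀ i j, res L (inf_le_left : V i ⊓ V j ≤ V i) (s i) =
      res L (inf_le_right : V i ⊓ V j ≤ V j) (s j)) :
    ∃ t : Γ(L, U), ∀ i, res L (hV i) t = s i := by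
  obtain ⟨t, ht, -⟩ := TopCat.Sheaf.existsUnique_gluing' ⟨_, L.isSheaf⟩ V U
    (fun i => homOfLE (hV i)) hU s (fun i j => h i j)
  exact ⟨t, ht⟩

variable (L U) in
/-- The section `e` of `L` on `U` is a basis of `L` on `U`. -/
def IsGenerator (e : Γ(L, U)) : Prop :=
  ∀ (V : X.Opens) (h : V ≤ U), Function.Bijective fun a : Γ(X, V) => a • res L h e

theorem IsGenerator.restrict {e : Γ(L, U)} (he : IsGenerator L U e) (h : V ≤ U) :
    IsGenerator L V (res L h e) := by
  intro W hW
  simpa only [res_res] using he W (hW.trans h)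

theorem IsGenerator.exists_smul {e : Γ(L, U)} (he : IsGenerator L U e) (s : Γ(L, U)) :
    ∃ a : Γ(X, U), a • e = s := by
  simpa only [res_self] using (he U le_rfl).2 s

theorem IsGenerator.smul_left_injective {e : Γ(L, U)} (he : IsGenerator L U e) {a b : Γ(X, U)}
    (h : a • e = b • e) : a = b :=
  (he U le_rfl).1 (by simpa only [res_self] using h)

theorem IsGenerator.eq_zero {e : Γ(L, U)} (he : IsGenerator L U e) {a : Γ(X, U)}
    (h : a • e = 0) : a = 0 :=
  he.smul_left_injective (by rw [h, zero_smul])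

end Restriction

/-! ### Sections of a line bundle on affine open subsets. -/

section QuasiCoherence

variable {X : Scheme.{0}} {L : X.Modules} {U V W : X.Opens}

theorem exists_resRing_eq (hU : IsAffineOpen U) (f : Γ(X, U)) (b : Γ(X, X.basicOpen f)) :
    ∃ (n : ℕ) (a : Γ(X, U)), resRing (X.basicOpen_le f) a = resRing (X.basicOpen_le f) f ^ n * b := by
  have := hU.isLocalization_basicOpen f
  obtain ⟨⟨a, ⟨_, n, rfl⟩⟩, h⟩ := IsLocalization.surj (.powers f) b
  refine ⟨n, a, ?_⟩
  rw [mul_comm, ← map_pow]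
  exact h.symm

theorem exists_pow_mul_eq_zero (hU : IsAffineOpen U) (f : Γ(X, U)) (a : Γ(X, U))
    (h : resRing (X.basicOpen_le f) a = 0) : ∃ n : ℕ, f ^ n * a = 0 := by
  have := hU.isLocalization_basicOpen f
  obtain ⟨⟨_, n, rfl⟩, h⟩ := (IsLocalization.map_eq_zero_iff (.powers f) Γ(X, X.basicOpen f) a).1 h
  exact ⟨n, h⟩

theorem isUnit_resRing (f : Γ(X, U)) : IsUnit (resRing (X.basicOpen_le f) f) :=
  RingedSpace.isUnit_res_basicOpen X.toRingedSpace f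

theorem IsGenerator.localizesAt {e : Γ(L, U)} (he : IsGenerator L U e) (hU : IsAffineOpen U)
    (f : Γ(X, U)) :
    LocalizesAt f (resRing (X.basicOpen_le f)) (res L (X.basicOpen_le f)) where
  isUnit := isUnit_resRing f
  surj m' := by
    obtain ⟨b, rfl⟩ := (he.restrict (X.basicOpen_le f)).exists_smul m'
    obtain ⟨n, a, h⟩ := exists_resRing_eq hU f b
    exact ⟨n, a • e, by rw [res_smul, h, mul_smul]⟩
  eq_zero m h := by
    obtain ⟨a, rfl⟩ := he.exists_smul m
    rw [res_smul] at h
    obtain ⟨n, hn⟩ := exists_pow_mul_eq_zero hU f a ((he.restrict (X.basicOpen_le f)).eq_zero h)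
    exact ⟨n, by rw [← mul_smul, hn, zero_smul]⟩
  ring_surj := exists_resRing_eq hU f

/-- `L` has a basis locally. -/
def LocallyGenerated (L : X.Modules) : Prop :=
  ∀ x : X, ∃ (U : X.Opens) (e : Γ(L, U)), x ∈ U ∧ IsGenerator L U e

theorem LocallyGenerated.exists_basicOpen (hL : LocallyGenerated L) (hU : IsAffineOpen U)
    {x : X} (hx : x ∈ U) (hxV : x ∈ V) :
    ∃ (f : Γ(X, U)) (e : Γ(L, X.basicOpen f)), x ∈ X.basicOpen f ∧ X.basicOpen f ≤ V ∧
      IsGenerator L (X.basicOpen f) e := by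
  obtain ⟨W, e, hxW, he⟩ := hL x
  obtain ⟨f, hf, hxf⟩ := hU.exists_basicOpen_le (V := W ⊓ V) ⟨x, hxW, hxV⟩ hx
  exact ⟨f, res L (hf.trans inf_le_left) e, hxf, hf.trans inf_le_right, he.restrict _⟩

theorem exists_finset_span_eq_top (hU : IsAffineOpen U) (p : Γ(X, U) → Prop)
    (h : ∀ x ∈ U, ∃ f : Γ(X, U), x ∈ X.basicOpen f ∧ p f) :
    ∃ s : Finset Γ(X, U), Ideal.span (s : Set Γ(X, U)) = ⊤ ∧ ∀ f ∈ s, p f := by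
  have h1 : Ideal.span {f | p f} = ⊤ := by
    rw [← hU.self_le_iSup_basicOpen_iff]
    intro x hx
    obtain ⟨f, hf, hp⟩ := h x hx
    exact TopologicalSpace.Opens.mem_iSup.2 ⟨⟨f, hp⟩, hf⟩
  obtain ⟨s, hs, h2⟩ := (Ideal.span_eq_top_iff_finite _).1 h1
  exact ⟨s, h2, fun f hf => hs hf⟩

/-- The classical argument for quasi-coherent sheaves. Cover U by finitely many basic open subsets
on which L has a basis, where the claim is that for functions. A multiple f^N m extends to each of
them, the extensions agree on overlaps after multiplication by a further f^K, and they are then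
glued. -/
theorem LocallyGenerated.localizesAt (hL : LocallyGenerated L) (hU : IsAffineOpen U)
    (f : Γ(X, U)) :
    LocalizesAt f (resRing (X.basicOpen_le f)) (res L (X.basicOpen_le f)) := by
  obtain ⟨s, hs, H⟩ := exists_finset_span_eq_top hU
    (fun g => ∃ e : Γ(L, X.basicOpen g), IsGenerator L (X.basicOpen g) e) (fun x hx => by
      obtain ⟨g, e, hxg, -, he⟩ := hL.exists_basicOpen (V := U) hU hx hx
      exact ⟨g, hxg, e, he⟩)
  choose! e he using H
  have hcov : U ≤ ⨆ g : s, X.basicOpen (g : Γ(X, U)) := hU.self_le_iSup_basicOpen_iff.2 hs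
  have hcov' : X.basicOpen f ≤ ⨆ g : s, X.basicOpen (g : Γ(X, U)) ⊓ X.basicOpen f := by
    rw [← iSup_inf_eq]
    exact le_inf ((X.basicOpen_le f).trans hcov) le_rfl
  -- The local case, for any affine W with a basis: it is applied to the members of the cover, and
  -- to their pairwise intersections in order to compare the extensions.
  have key : ∀ (W : X.Opens) (hW : IsAffineOpen W) (hWU : W ≤ U) (b : Γ(L, W)),
      IsGenerator L W b → 
      (∀ m : Γ(L, W ⊓ X.basicOpen f), ∃ (n : ℕ) (t : Γ(L, W)),
        res L (inf_le_left : W ⊓ X.basicOpen f ≤ W) t =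
          resRing ((inf_le_left : W ⊓ X.basicOpen f ≤ W).trans hWU) f ^ n • m) ∧
      (∀ t : Γ(L, W), res L (inf_le_left : W ⊓ X.basicOpen f ≤ W) t = 0 →
        ∃ n : ℕ, resRing hWU f ^ n • t = 0) := by
    intro W hW hWU b hb
    have h1 := hb.localizesAt hW (resRing hWU f)
    have h2 : W ⊓ X.basicOpen f = X.basicOpen (resRing hWU f) :=
      (X.basicOpen_res f (homOfLE hWU).op).symm
    suffices ∀ (V : X.Opens) (hV : V ≤ W), V = X.basicOpen (resRing hWU f) →
        (∀ m : Γ(L, V), ∃ (n : ℕ) (t : Γ(L, W)), res L hV t = resRing (hV.trans hWU) f ^ n • m) ∧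
        (∀ t : Γ(L, W), res L hV t = 0 → ∃ n : ℕ, resRing hWU f ^ n • t = 0) from
      this _ inf_le_left h2
    rintro V hV rfl
    refine ⟨fun m => ?_, fun t ht => h1.eq_zero t ht⟩
    obtain ⟨n, t, h⟩ := h1.surj m
    exact ⟨n, t, by rw [h, resRing_resRing]⟩
  refine ⟨isUnit_resRing f, fun m => ?_, fun m hm => ?_, exists_resRing_eq hU f⟩
  · have h1 : ∀ g : s, ∃ (n : ℕ) (t : Γ(L, X.basicOpen (g : Γ(X, U)))),
        res L (inf_le_left : X.basicOpen g.1 ⊓ X.basicOpen f ≤ _) t =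
          resRing ((inf_le_left : X.basicOpen g.1 ⊓ X.basicOpen f ≤ _).trans
            (X.basicOpen_le g.1)) f ^ n •
          res L (inf_le_right : X.basicOpen g.1 ⊓ X.basicOpen f ≤ _) m := fun g =>
      (key _ (hU.basicOpen g.1) (X.basicOpen_le _) _ (he g.1 g.2)).1 _
    choose n t ht using h1
    let N := Finset.univ.sup n
    have hN : ∀ g, n g ≤ N := fun g => Finset.le_sup (Finset.mem_univ g)
    let t' : ∀ g : s, Γ(L, X.basicOpen (g : Γ(X, U))) := fun g =>
      resRing (X.basicOpen_le g.1) f ^ (N - n g) • t g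
    have ht' : ∀ g : s, res L (inf_le_left : X.basicOpen g.1 ⊓ X.basicOpen f ≤ _) (t' g) =
        resRing ((inf_le_left : X.basicOpen g.1 ⊓ X.basicOpen f ≤ _).trans
            (X.basicOpen_le g.1)) f ^ N •
          res L (inf_le_right : X.basicOpen g.1 ⊓ X.basicOpen f ≤ _) m := fun g => by
      simp only [t']
      rw [res_smul, ht, map_pow, resRing_resRing, smul_smul, ← pow_add, Nat.sub_add_cancel (hN g)]
    have h2 : ∀ g g' : s, ∃ k : ℕ,
        resRing ((inf_le_left : X.basicOpen g.1 ⊓ X.basicOpen g'.1 ≤ _).trans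
            (X.basicOpen_le g.1)) f ^ k •
          (res L (inf_le_left : X.basicOpen g.1 ⊓ X.basicOpen g'.1 ≤ _) (t' g) -
          res L (inf_le_right : X.basicOpen g.1 ⊓ X.basicOpen g'.1 ≤ _) (t' g')) = 0 := by
      intro g g'
      have hW : IsAffineOpen (X.basicOpen g.1 ⊓ X.basicOpen g'.1) := by
        rw [← X.basicOpen_mul]
        exact hU.basicOpen _
      refine (key _ hW (inf_le_left.trans (X.basicOpen_le _)) _
        ((he g.1 g.2).restrict inf_le_left)).2 _ ?_
      have h3 := congr(res L (show X.basicOpen g.1 ⊓ X.basicOpen g'.1 ⊓ X.basicOpen f ≤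
        X.basicOpen g.1 ⊓ X.basicOpen f from inf_le_inf_right _ inf_le_left) $(ht' g))
      have h4 := congr(res L (show X.basicOpen g.1 ⊓ X.basicOpen g'.1 ⊓ X.basicOpen f ≤
        X.basicOpen g'.1 ⊓ X.basicOpen f from inf_le_inf_right _ inf_le_right) $(ht' g'))
      simp only [res_res, res_smul, map_pow, resRing_resRing] at h3 h4
      rw [map_sub, res_res, res_res, h3, h4, sub_self]
    choose k hk using h2
    -- One exponent that kills the differences on all overlaps; it exists because the cover is
    -- finite.
    let K := Finset.univ.sup fun g => Finset.univ.sup (k g)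
    have hK : ∀ g g', k g g' ≤ K := fun g g' =>
      (Finset.le_sup (f := k g) (Finset.mem_univ g')).trans
        (Finset.le_sup (f := fun g => Finset.univ.sup (k g)) (Finset.mem_univ g))
    obtain ⟨T, hT⟩ := exists_glue (fun g : s => X.basicOpen (g : Γ(X, U)))
      (fun g => X.basicOpen_le g.1) hcov
      (fun g => resRing (X.basicOpen_le g.1) f ^ K • t' g) (fun g g' => by
        simp only [res_smul, map_pow, resRing_resRing]
        rw [← sub_eq_zero, ← smul_sub, ← Nat.sub_add_cancel (hK g g'), pow_add, mul_smul, hk,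
          smul_zero])
    refine ⟨K + N, T, res_ext (fun g : s => X.basicOpen g.1 ⊓ X.basicOpen f)
      (fun g => inf_le_right) hcov' fun g => ?_⟩
    have h3 := congr(res L (inf_le_left : X.basicOpen g.1 ⊓ X.basicOpen f ≤ _) $(hT g))
    rw [res_res, res_smul, ht', map_pow, resRing_resRing, smul_smul, ← pow_add] at h3
    rw [res_res, h3, res_smul, map_pow, resRing_resRing]
  · have h1 : ∀ g : s, ∃ n : ℕ,
        resRing (X.basicOpen_le g.1) f ^ n • res L (X.basicOpen_le g.1) m = 0 := fun g => by
      refine (key _ (hU.basicOpen g.1) (X.basicOpen_le _) _ (he g.1 g.2)).2 _ ?_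
      have h2 := congr(res L (inf_le_right : X.basicOpen g.1 ⊓ X.basicOpen f ≤ _) $hm)
      rw [res_res, map_zero] at h2
      rwa [res_res]
    choose n hn using h1
    refine ⟨Finset.univ.sup n, res_ext (fun g : s => X.basicOpen g.1)
      (fun g => X.basicOpen_le g.1) hcov fun g => ?_⟩
    rw [res_smul, map_pow, map_zero,
      ← Nat.sub_add_cancel (Finset.le_sup (f := n) (Finset.mem_univ g)), pow_add, mul_smul, hn,
      smul_zero]

/-- A basis e on a basic open subset D(f) extends to U after multiplication by a power of f; the
extension t generates L(U) up to powers of f. -/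
theorem LocallyGenerated.locallyCyclic (hL : LocallyGenerated L) (hU : IsAffineOpen U) :
    LocallyCyclic Γ(X, U) Γ(L, U) := by
  obtain ⟨s, hs, H⟩ := exists_finset_span_eq_top hU
    (fun g => ∃ e : Γ(L, X.basicOpen g), IsGenerator L (X.basicOpen g) e) (fun x hx => by
      obtain ⟨g, e, hxg, -, he⟩ := hL.exists_basicOpen (V := U) hU hx hx
      exact ⟨g, hxg, e, he⟩)
  refine ⟨s, hs, fun f hf => ?_⟩
  obtain ⟨e, he⟩ := H f hf
  have h := hL.localizesAt hU f
  obtain ⟨n, t, ht⟩ := h.surj e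
  refine ⟨t, fun m => ?_⟩
  obtain ⟨a, ha⟩ := he.exists_smul (res L (X.basicOpen_le f) m)
  obtain ⟨k, b, hb⟩ := h.ring_surj a
  obtain ⟨j, hj⟩ := h.exists_smul_eq (m₁ := f ^ (k + n) • m) (m₂ := b • t) (by
    rw [res_smul, res_smul, hb, ht, ← ha, map_pow, smul_smul, smul_smul]
    congr 1
    ring)
  exact ⟨j + (k + n), f ^ j * b, by rw [pow_add, mul_smul, hj, mul_smul]⟩

/-- Membership in a submodule of the sections on an affine open subset is local. -/
theorem LocallyGenerated.mem_of_locally (hL : LocallyGenerated L) (hU : IsAffineOpen U)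
    (N : Submodule Γ(X, U) Γ(L, U)) (m : Γ(L, U))
    (h : ∀ x ∈ U, ∃ f : Γ(X, U), x ∈ X.basicOpen f ∧
      res L (X.basicOpen_le f) m ∈
        Submodule.span Γ(X, X.basicOpen f) (res L (X.basicOpen_le f) '' N)) : m ∈ N := by
  obtain ⟨s, hs, H⟩ := exists_finset_span_eq_top hU _ h
  exact Submodule.mem_of_span_eq_top_of_smul_pow_mem _ _ hs _ fun f =>
    (hL.localizesAt hU f.1).exists_smul_mem (H f f.2)

end QuasiCoherence

/-! ### Line bundles have local bases. -/

section LineBundle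

variable {X : Scheme.{0}}

variable (X) in
/-- The structure sheaf, as a sheaf of modules. -/
def structureModule : X.Modules := SheafOfModules.unit X.ringCatSheaf

/-- A function, as a section of the structure sheaf. -/
def sectionOf {U : X.Opens} (a : Γ(X, U)) : Γ(structureModule X, U) := a

/-- A section of the structure sheaf, as a function. -/
def functionOf {U : X.Opens} (a : Γ(structureModule X, U)) : Γ(X, U) := a

theorem smul_sectionOf {U : X.Opens} (a b : Γ(X, U)) : a • sectionOf b = sectionOf (a * b) := rfl

theorem res_sectionOf {U V : X.Opens} (h : V ≤ U) (a : Γ(X, U)) :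
    res (structureModule X) h (sectionOf a) = sectionOf (resRing h a) := rfl

theorem hom_app_res {L M : X.Modules} (φ : L ⟶ M) {U V : X.Opens} (h : V ≤ U) (s : Γ(L, U)) :
    φ.app V (res L h s) = res M h (φ.app U s) :=
  congr($(φ.mapPresheaf.naturality (homOfLE h).op) s)

theorem bijective_app_hom {L M : X.Modules} (ψ : L ≅ M) (U : X.Opens) :
    Function.Bijective (ψ.hom.app U) := by
  have := (Scheme.Modules.Hom.isIso_iff_isIso_app (φ := ψ.hom)).1 inferInstance U
  exact ConcreteCategory.bijective_of_isIso (ψ.hom.app U)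

/-- The basis is the image of the function 1 under a local trivialization. What remains is to match
the scalar action on the restricted sheaf with the one on L. -/
theorem IsLineBundle.locallyGenerated {L : X.Modules} (hL : IsLineBundle L) :
    LocallyGenerated L := by
  intro x
  obtain ⟨U, hxU, ⟨ψ⟩⟩ := hL x
  let φ : structureModule U.toScheme ≅ L.restrict U.ι := ψ.symm
  let e : Γ(L.restrict U.ι, ⊤) := φ.hom.app ⊤ (sectionOf 1)
  refine ⟨U.ι ''ᵁ ⊤, e, by simpa using hxU, fun V hV => ?_⟩
  obtain ⟨W, rfl⟩ : ∃ W : U.toScheme.Opens, V = U.ι ''ᵁ W :=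
    ⟨U.ι ⁻¹ᵁ V, by
      rw [Scheme.Hom.image_preimage_eq_opensRange_inf, Scheme.Opens.opensRange_ι]
      exact (inf_eq_right.2 (by simpa using hV)).symm⟩
  have h1 := bijective_app_hom φ W
  have h2 : ∀ a : Γ(U.toScheme, W), φ.hom.app W (sectionOf a) =
      a • res (L.restrict U.ι) le_top e := by
    intro a
    have h3 := Scheme.Modules.Hom.app_smul φ.hom a (sectionOf 1)
    rw [smul_sectionOf, mul_one] at h3
    rw [h3, ← hom_app_res, res_sectionOf, map_one]
  have h3 : ∀ (a : Γ(U.toScheme, W)) (s : Γ(L.restrict U.ι, W)),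
      a • s = (show Γ(L, U.ι ''ᵁ W) from (show Γ(X, U.ι ''ᵁ W) from a) •
        (show Γ(L, U.ι ''ᵁ W) from s)) := by
    intro a s
    have := Scheme.Modules.smul_restrictAppIso_hom_apply U.ι L W a s
    rw [Scheme.Opens.ι_appIso] at this
    exact this
  have h4 : (fun a : Γ(X, U.ι ''ᵁ W) => a • res L hV e) =
      fun a => φ.hom.app W (sectionOf a) := by
    funext a
    exact ((h2 a).trans (h3 a _)).symm
  rw [h4]
  exact h1

end LineBundle

/-! ### Existence of the ideal sheaf of the base points. -/

section BaseIdeal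

variable {R : Type} [CommRing R] {X : Scheme.{0}} (π : X ⟶ Spec (.of R)) {L : X.Modules}
  (F : Submodule R (DirectImage π L))

theorem generatedSections_eq_span_image {U V : X.Opens} (h : V ≤ U) :
    generatedSections π L F V =
      Submodule.span Γ(X, V) (res L h '' generatedSections π L F U) := by
  apply le_antisymm
  · refine Submodule.span_mono ?_
    rintro _ ⟨s, hs, rfl⟩
    refine ⟨L.presheaf.map (homOfLE le_top : U ⟶ ⊤).op s, Submodule.subset_span ⟨s, hs, rfl⟩, ?_⟩
    exact res_res _ _ _
  · rw [Submodule.span_le]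
    rintro _ ⟨t, ht, rfl⟩
    induction ht using Submodule.span_induction with
    | mem t ht =>
      obtain ⟨s, hs, rfl⟩ := ht
      refine Submodule.subset_span ⟨s, hs, ?_⟩
      exact res_res _ _ _
    | zero => rw [map_zero]; exact zero_mem _
    | add t t' _ _ h h' => rw [map_add]; exact add_mem h h'
    | smul a t _ h => rw [res_smul]; exact Submodule.smul_mem _ _ h

/-- The ideal sheaf `U ↦ (generatedSections U : L(U))`. -/
def colonIdealSheaf (hL : LocallyGenerated L) : X.IdealSheafData where
  ideal U := colonIdeal (generatedSections π L F U)
  map_ideal_basicOpen U f := by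
    have := (hL.locallyCyclic U.2).finite
    rw [show generatedSections π L F (X.affineBasicOpen f) = _ from
      generatedSections_eq_span_image π F (X.basicOpen_le f)]
    exact (hL.localizesAt U.2 f).map_colonIdeal _

/-- The supremum `baseIdeal` is the sheaf of colon ideals: every competitor is contained in the
colon ideals by their definition, and the colon sheaf is itself a competitor. Its product with L is
everything generated by F since L is locally cyclic. -/
theorem baseIdeal_smul_top (hL : LocallyGenerated L) (U : X.affineOpens) :
    (baseIdeal π L F).ideal U • (⊤ : Submodule Γ(X, U) Γ(L, U)) = generatedSections π L F U := by
  apply le_antisymm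
  · rw [← le_colonIdeal_iff]
    have h : baseIdeal π L F ≤ colonIdealSheaf π F hL :=
      sSup_le fun I hI U => le_colonIdeal_iff.2 (hI U)
    exact h U
  · have h : colonIdealSheaf π F hL ≤ baseIdeal π L F :=
      le_sSup fun U => ((hL.locallyCyclic U.2).colonIdeal_smul_top _).le
    rw [← (hL.locallyCyclic U.2).colonIdeal_smul_top (generatedSections π L F U)]
    exact Submodule.smul_mono_left (h U)

end BaseIdeal

/-! ### Pull-back of sections and the universal property of the pull-back sheaf. -/

section Pullback

variable {X Y : Scheme.{0}}

/-- A morphism of sheaves of modules, from its action on sections. -/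
def homMk {L M : X.Modules} (φ : ∀ U : X.Opens, Γ(L, U) →ₗ[Γ(X, U)] Γ(M, U))
    (h : ∀ (U V : X.Opens) (h : V ≤ U) (s : Γ(L, U)), res M h (φ U s) = φ V (res L h s)) :
    L ⟶ M :=
  ⟨fun U => ModuleCat.ofHom ⟨⟨φ U.unop, map_add _⟩, fun a s => (φ U.unop).map_smul a s⟩,
    fun {U V} i => by
      ext s
      exact (h U.unop V.unop i.unop.le s).symm⟩

/-- Restriction of a function along a morphism. -/
abbrev appRing (f : Y ⟶ X) {U : X.Opens} {V : Y.Opens} (h : V ≤ f ⁻¹ᵁ U) : Γ(X, U) →+* Γ(Y, V) :=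
  (f.appLE U V h).hom

variable (f : Y ⟶ X) (L : X.Modules)

theorem app_eq_appRing {U : X.Opens} (a : Γ(X, U)) : f.app U a = appRing f le_rfl a := by
  rw [appRing, Scheme.Hom.appLE]
  exact (resRing_self (X := Y) _).symm

theorem resRing_appRing {U : X.Opens} {V W : Y.Opens} (h : V ≤ f ⁻¹ᵁ U) (h' : W ≤ V) (a : Γ(X, U)) :
    resRing h' (appRing f h a) = appRing f (h'.trans h) a := by
  rw [← RingHom.comp_apply, ← CommRingCat.hom_comp, Scheme.Hom.appLE_map]

theorem appRing_resRing {U U' : X.Opens} {V : Y.Opens} (h : V ≤ f ⁻¹ᵁ U') (h' : U' ≤ U)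
    (a : Γ(X, U)) :
    appRing f h (resRing h' a) = appRing f (h.trans (f.preimage_mono h')) a := by
  rw [← RingHom.comp_apply, ← CommRingCat.hom_comp, Scheme.Hom.map_appLE]

/-- The pull-back of sections along `f`. -/
def pull {U : X.Opens} {V : Y.Opens} (h : V ≤ f ⁻¹ᵁ U) :
    Γ(L, U) →ₛₗ[appRing f h] Γ((Scheme.Modules.pullback f).obj L, V) where
  toFun s := res ((Scheme.Modules.pullback f).obj L) h
    (((Scheme.Modules.pullbackPushforwardAdjunction f).unit.app L).app U s)
  map_add' s t := by
    rw [map_add]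
    exact map_add (res ((Scheme.Modules.pullback f).obj L) h) _ _
  map_smul' a s := by
    rw [Scheme.Modules.Hom.app_smul]
    have h1 : ∀ t : Γ((Scheme.Modules.pullback f).obj L, f ⁻¹ᵁ U),
      res ((Scheme.Modules.pullback f).obj L) h (f.app U a • t) =
        appRing f h a • res ((Scheme.Modules.pullback f).obj L) h t := by
      intro t
      rw [res_smul, app_eq_appRing, resRing_appRing]
    exact h1 _

variable {L}

theorem res_pull {U : X.Opens} {V W : Y.Opens} (h : V ≤ f ⁻¹ᵁ U) (h' : W ≤ V) (s : Γ(L, U)) :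
    res _ h' (pull f L h s) = pull f L (h'.trans h) s :=
  res_res _ _ _

theorem pull_res {U U' : X.Opens} {V : Y.Opens} (h : V ≤ f ⁻¹ᵁ U') (h' : U' ≤ U) (s : Γ(L, U)) :
    pull f L h (res L h' s) = pull f L (h.trans (f.preimage_mono h')) s := by
  have h1 := hom_app_res ((Scheme.Modules.pullbackPushforwardAdjunction f).unit.app L) h' s
  refine (congrArg (res ((Scheme.Modules.pullback f).obj L) h) h1).trans ?_
  exact res_res (L := (Scheme.Modules.pullback f).obj L) (f.preimage_mono h') h _

theorem pull_smul {U : X.Opens} {V : Y.Opens} (h : V ≤ f ⁻¹ᵁ U) (a : Γ(X, U)) (s : Γ(L, U)) :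
    pull f L h (a • s) = appRing f h a • pull f L h s := map_smulₛₗ _ _ _

theorem pull_self {U : X.Opens} (s : Γ(L, U)) : pull f L le_rfl s =
    ((Scheme.Modules.pullbackPushforwardAdjunction f).unit.app L).app U s :=
  res_self _

/-- By adjunction a morphism from f^*L is determined by its transpose, that is, by its values on the
sections pulled back from L. -/
theorem pullback_hom_ext {G : Y.Modules} {α β : (Scheme.Modules.pullback f).obj L ⟶ G}
    (h : ∀ (U : X.Opens) (s : Γ(L, U)), α.app _ (pull f L (le_refl (f ⁻¹ᵁ U)) s) =
      β.app _ (pull f L (le_refl (f ⁻¹ᵁ U)) s)) : α = β := by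
  apply ((Scheme.Modules.pullbackPushforwardAdjunction f).homEquiv L G).injective
  rw [Adjunction.homEquiv_unit, Adjunction.homEquiv_unit]
  ext U s
  have := h U s
  rw [pull_self] at this
  exact this

theorem exists_pullback_hom {G : Y.Modules} (μ : L ⟶ (Scheme.Modules.pushforward f).obj G) :
    ∃ l : (Scheme.Modules.pullback f).obj L ⟶ G, ∀ (U : X.Opens) (s : Γ(L, U)),
      l.app _ (pull f L (le_refl (f ⁻¹ᵁ U)) s) = μ.app U s := by
  obtain ⟨l, rfl⟩ := ((Scheme.Modules.pullbackPushforwardAdjunction f).homEquiv L G).surjective μ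
  refine ⟨l, fun U s => ?_⟩
  rw [Adjunction.homEquiv_unit, pull_self]
  rfl

end Pullback

/-! ### The extension by direct image from an open subset, and the pull-back of a local basis. -/

section OnOpen

variable {Y : Scheme.{0}} (V : Y.Opens) (N : Y.Modules)

/-- The sheaf `W ↦ N(V ∩ W)`. -/
def onOpen : Y.Modules := (Scheme.Modules.pushforward V.ι).obj (N.restrict V.ι)

/-- The intersection `V ∩ W`, as the image of the preimage of `W`. -/
abbrev cut (W : Y.Opens) : Y.Opens := V.ι ''ᵁ (V.ι ⁻¹ᵁ W)

theorem cut_eq (W : Y.Opens) : cut V W = V ⊓ W := by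
  rw [cut, Scheme.Hom.image_preimage_eq_opensRange_inf, Scheme.Opens.opensRange_ι]

theorem cut_le_left (W : Y.Opens) : cut V W ≤ V := (cut_eq V W).le.trans inf_le_left

theorem cut_le_right (W : Y.Opens) : cut V W ≤ W := (cut_eq V W).le.trans inf_le_right

theorem cut_mono {W W' : Y.Opens} (h : W' ≤ W) : cut V W' ≤ cut V W := by
  rw [cut_eq, cut_eq]; exact inf_le_inf_left _ h

variable {V N}

/-- Sections of `onOpen V N`. -/
def toOnOpen {W : Y.Opens} : Γ(N, cut V W) ≃+ Γ(onOpen V N, W) := AddEquiv.refl _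

theorem smul_toOnOpen {W : Y.Opens} (a : Γ(Y, W)) (s : Γ(N, cut V W)) :
    a • toOnOpen s = toOnOpen (resRing (cut_le_right V W) a • s) := by
  have h := Scheme.Modules.smul_restrictAppIso_hom_apply V.ι N (V.ι ⁻¹ᵁ W) (V.ι.app W a) s
  rw [← ConcreteCategory.comp_apply, Scheme.Hom.app_appIso_inv] at h
  exact h

theorem res_toOnOpen {W W' : Y.Opens} (h : W' ≤ W) (s : Γ(N, cut V W)) :
    res (onOpen V N) h (toOnOpen s) = toOnOpen (res N (cut_mono V h) s) := rfl

end OnOpen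

section Coordinate

variable {X : Scheme.{0}} {L : X.Modules} {U : X.Opens} {e : Γ(L, U)}

/-- The coordinate of a section with respect to a basis. -/
def coord (he : IsGenerator L U e) {W : X.Opens} (h : W ≤ U) (s : Γ(L, W)) : Γ(X, W) :=
  ((he W h).2 s).choose

theorem coord_smul (he : IsGenerator L U e) {W : X.Opens} (h : W ≤ U) (s : Γ(L, W)) :
    coord he h s • res L h e = s := ((he W h).2 s).choose_spec

theorem coord_eq (he : IsGenerator L U e) {W : X.Opens} (h : W ≤ U) {s : Γ(L, W)} {a : Γ(X, W)}
    (ha : a • res L h e = s) : coord he h s = a :=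
  (he W h).1 ((coord_smul he h s).trans ha.symm)

theorem coord_res (he : IsGenerator L U e) {W W' : X.Opens} (h : W ≤ U) (h' : W' ≤ W)
    (s : Γ(L, W)) : coord he (h'.trans h) (res L h' s) = resRing h' (coord he h s) := by
  apply coord_eq
  conv_rhs => rw [← coord_smul he h s]
  rw [res_smul, res_res]

theorem coord_add (he : IsGenerator L U e) {W : X.Opens} (h : W ≤ U) (s t : Γ(L, W)) :
    coord he h (s + t) = coord he h s + coord he h t := by
  apply coord_eq
  rw [add_smul, coord_smul, coord_smul]

theorem coord_mul (he : IsGenerator L U e) {W : X.Opens} (h : W ≤ U) (a : Γ(X, W)) (s : Γ(L, W)) :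
    coord he h (a • s) = a * coord he h s := by
  apply coord_eq
  rw [mul_smul, coord_smul]

end Coordinate

section PullbackGenerator

variable {X Y : Scheme.{0}} (f : Y ⟶ X) {L : X.Modules} {U : X.Opens} {e : Γ(L, U)}

theorem cut_preimage_le (W : X.Opens) : cut (f ⁻¹ᵁ U) (f ⁻¹ᵁ W) ≤ f ⁻¹ᵁ (U ⊓ W) :=
  (cut_eq _ _).le

/-- The functions `f^* a`, for `s = a • e` a section of `L`. -/
def coordHom (he : IsGenerator L U e) :
    L ⟶ (Scheme.Modules.pushforward f).obj (onOpen (f ⁻¹ᵁ U) (structureModule Y)) :=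
  homMk (fun W =>
    { toFun := fun s => (toOnOpen (sectionOf (appRing f (cut_preimage_le f W)
        (coord he inf_le_left (res L (inf_le_right : U ⊓ W ≤ W) s)))) :
          Γ(onOpen (f ⁻¹ᵁ U) (structureModule Y), f ⁻¹ᵁ W))
      map_add' := fun s t => by
        rw [map_add, coord_add, map_add]
        rfl
      map_smul' := fun a s => by
        rw [res_smul, coord_mul, map_mul, appRing_resRing]
        refine Eq.trans ?_ (smul_toOnOpen (V := f ⁻¹ᵁ U) (N := structureModule Y) (f.app W a) _).symm
        rw [smul_sectionOf, app_eq_appRing, resRing_appRing] })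
    (fun W W' h s => by
      refine (res_toOnOpen (V := f ⁻¹ᵁ U) (N := structureModule Y) (f.preimage_mono h) _).trans ?_
      have h1 := coord_res he (inf_le_left : U ⊓ W ≤ U)
        (inf_le_inf_left U h : U ⊓ W' ≤ U ⊓ W) (res L (inf_le_right : U ⊓ W ≤ W) s)
      rw [res_sectionOf, resRing_appRing]
      change _ = toOnOpen (sectionOf (appRing f (cut_preimage_le f W')
        (coord he inf_le_left (res L (inf_le_right : U ⊓ W' ≤ W') (res L h s)))))
      rw [res_res] at h1 ⊢
      rw [h1, appRing_resRing])

variable (N : Y.Modules) {V : Y.Opens}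

/-- Multiplication by a section `e` of `N` on `V`. -/
def smulHom (e : Γ(N, V)) : onOpen V (structureModule Y) ⟶ onOpen V N :=
  homMk (fun W =>
    { toFun := fun a => toOnOpen (functionOf (toOnOpen.symm a) • res N (cut_le_left V W) e)
      map_add' := fun a b => by
        rw [← map_add, ← add_smul]
        rfl
      map_smul' := fun a b => by
        rw [RingHom.id_apply, smul_toOnOpen, smul_smul]
        obtain ⟨b, rfl⟩ := toOnOpen.surjective b
        rw [smul_toOnOpen]
        rfl })
    (fun W W' h a => by
      change res (onOpen V N) h (toOnOpen _) = toOnOpen (_ • _)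
      rw [res_toOnOpen, res_smul, res_res]
      rfl)

variable (V) in
/-- The restriction map from `N` to `onOpen V N`. -/
def restrictHom : N ⟶ onOpen V N :=
  homMk (fun W =>
    { toFun := fun s => toOnOpen (res N (cut_le_right V W) s)
      map_add' := fun s t => by rw [map_add, map_add]
      map_smul' := fun a s => by
        rw [RingHom.id_apply, smul_toOnOpen, res_smul] })
    (fun W W' h s => by
      change res (onOpen V N) h (toOnOpen _) = toOnOpen _
      rw [res_toOnOpen, res_res, res_res])

variable {N} in
-- The morphism l plays the role of the coordinate with respect to e: `key` says that l(n) · e = n,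
-- whence surjectivity of a ↦ a e, and `hl` gives l(a e) = a, whence injectivity.
theorem isGenerator_of_comp_smulHom (e : Γ(N, V)) (l : N ⟶ onOpen V (structureModule Y))
    (key : l ≫ smulHom N e = restrictHom N V) (hl : l.app V e = toOnOpen (sectionOf 1)) :
    IsGenerator N V e := by
  intro W hW
  have hcut : W ≤ cut V W := (le_inf hW le_rfl).trans (cut_eq V W).ge
  have h1 : ∀ n : Γ(N, W), functionOf (toOnOpen.symm (l.app W n)) • res N (cut_le_left V W) e =
      res N (cut_le_right V W) n := fun n => congr((toOnOpen (V := V) (N := N)).symm (($key).app W n))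
  have h2 : l.app W (res N hW e) = toOnOpen (sectionOf 1) := by
    rw [hom_app_res, hl, res_toOnOpen, res_sectionOf, map_one]
  have h3 : ∀ a : Γ(Y, W), resRing hcut (functionOf (toOnOpen.symm
      (l.app W (a • res N hW e)))) = a := by
    intro a
    rw [Scheme.Modules.Hom.app_smul, h2, smul_toOnOpen, AddEquiv.symm_apply_apply]
    change resRing hcut (resRing (cut_le_right V W) a * 1) = a
    rw [mul_one, resRing_resRing, resRing_self]
  constructor
  · intro a b hab
    exact (h3 a).symm.trans (congr(resRing hcut (functionOf (toOnOpen.symm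
      (l.app W $hab)))).trans (h3 b))
  · intro n
    refine ⟨resRing hcut (functionOf (toOnOpen.symm (l.app W n))), ?_⟩
    have h4 := congr(res N hcut $(h1 n))
    rw [res_smul, res_res, res_res, res_self] at h4
    exact h4

/-- It is enough to test on pulled back sections, and there the identity is the pull-back of s = a ·
e on U ∩ W. -/
theorem comp_smulHom_eq_restrictHom (he : IsGenerator L U e)
    (l : (Scheme.Modules.pullback f).obj L ⟶ onOpen (f ⁻¹ᵁ U) (structureModule Y))
    (hl : ∀ (W : X.Opens) (s : Γ(L, W)),
      l.app _ (pull f L (le_refl (f ⁻¹ᵁ W)) s) = (coordHom f he).app W s) :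
    l ≫ smulHom _ (pull f L (le_refl (f ⁻¹ᵁ U)) e) = restrictHom _ (f ⁻¹ᵁ U) := by
  refine pullback_hom_ext f fun W s => ?_
  refine (congrArg ((smulHom _ (pull f L (le_refl (f ⁻¹ᵁ U)) e)).app (f ⁻¹ᵁ W)) (hl W s)).trans ?_
  have h1 := congr(pull f L (cut_preimage_le (U := U) f W)
    $(coord_smul he (inf_le_left : U ⊓ W ≤ U) (res L (inf_le_right : U ⊓ W ≤ W) s)))
  rw [pull_smul, pull_res, pull_res] at h1
  have h2 := res_pull f (le_refl (f ⁻¹ᵁ U)) (cut_le_left (f ⁻¹ᵁ U) (f ⁻¹ᵁ W)) e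
  have h3 := res_pull f (le_refl (f ⁻¹ᵁ W)) (cut_le_right (f ⁻¹ᵁ U) (f ⁻¹ᵁ W)) s
  rw [← h2, ← h3] at h1
  exact congrArg (toOnOpen (V := f ⁻¹ᵁ U)) h1

/-- The pull-back of a basis is a basis. -/
theorem IsGenerator.pullback (he : IsGenerator L U e) {V' : Y.Opens} (hV' : V' ≤ f ⁻¹ᵁ U) :
    IsGenerator ((Scheme.Modules.pullback f).obj L) V' (pull f L hV' e) := by
  suffices h : IsGenerator ((Scheme.Modules.pullback f).obj L) (f ⁻¹ᵁ U)
      (pull f L le_rfl e) by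
    rw [← res_pull f le_rfl hV']
    exact IsGenerator.restrict h hV'
  -- The coordinate on f^*L is the adjoint transpose of s = a e ↦ f^*a.
  obtain ⟨l, hl⟩ := exists_pullback_hom f (coordHom f he)
  have key := comp_smulHom_eq_restrictHom f he l hl
  refine isGenerator_of_comp_smulHom _ _ key ?_
  rw [hl]
  change toOnOpen (sectionOf (appRing f (cut_preimage_le f U)
      (coord he inf_le_left (res L (inf_le_right : U ⊓ U ≤ U) e)))) = _
  rw [coord_eq he inf_le_left (one_smul _ _), map_one]

theorem LocallyGenerated.pullback (hL : LocallyGenerated L) :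
    LocallyGenerated ((Scheme.Modules.pullback f).obj L) := fun y => by
  obtain ⟨U, e, hx, he⟩ := hL (f y)
  exact ⟨f ⁻¹ᵁ U, _, hx, he.pullback f le_rfl⟩

/-- The isomorphism between the two pull-backs corresponds, under conjugation of adjunctions, to the
identification of the direct images. So it respects the units, by which sections are pulled back. -/
theorem pull_pull {Z : Scheme.{0}} (g : Z ⟶ Y) (L : X.Modules) {U : X.Opens} {V : Y.Opens}
    {W : Z.Opens} (h : V ≤ f ⁻¹ᵁ U) (h' : W ≤ g ⁻¹ᵁ V) (s : Γ(L, U)) :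
    ((Scheme.Modules.pullbackComp g f).hom.app L).app W (pull g _ h' (pull f L h s)) =
      pull (g ≫ f) L (h'.trans (g.preimage_mono h)) s := by
  have h1 := unit_conjugateEquiv ((Scheme.Modules.pullbackPushforwardAdjunction f).comp
    (Scheme.Modules.pullbackPushforwardAdjunction g))
    (Scheme.Modules.pullbackPushforwardAdjunction (g ≫ f)) (Scheme.Modules.pullbackComp g f).inv L
  rw [Scheme.Modules.conjugateEquiv_pullbackComp_inv] at h1
  have h2 : pull g _ le_rfl (pull f L le_rfl s) =
      ((Scheme.Modules.pullbackComp g f).inv.app L).app (g ⁻¹ᵁ f ⁻¹ᵁ U)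
        (pull (g ≫ f) L (le_refl (g ⁻¹ᵁ f ⁻¹ᵁ U)) s) := by
    rw [pull_self, pull_self]
    refine Eq.trans ?_ (congrArg (((Scheme.Modules.pullbackComp g f).inv.app L).app (g ⁻¹ᵁ f ⁻¹ᵁ U))
      (pull_self (g ≫ f) s).symm)
    exact congr(($h1).app U s)
  have h3 : ∀ t, ((Scheme.Modules.pullbackComp g f).hom.app L).app (g ⁻¹ᵁ f ⁻¹ᵁ U)
      (((Scheme.Modules.pullbackComp g f).inv.app L).app (g ⁻¹ᵁ f ⁻¹ᵁ U) t) = t := fun t =>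
    congr(($((Scheme.Modules.pullbackComp g f).inv_hom_id_app L)).app (g ⁻¹ᵁ f ⁻¹ᵁ U) t)
  have h4 : pull g _ h' (pull f L h s) = res _ (h'.trans (g.preimage_mono h))
      (pull g _ le_rfl (pull f L le_rfl s)) := by
    rw [← res_pull f le_rfl h, pull_res, res_pull]
  rw [h4]
  refine (hom_app_res ((Scheme.Modules.pullbackComp g f).hom.app L)
    (h'.trans (g.preimage_mono h)) _).trans ?_
  refine (congrArg (fun t => res _ (h'.trans (g.preimage_mono h))
    (((Scheme.Modules.pullbackComp g f).hom.app L).app (g ⁻¹ᵁ f ⁻¹ᵁ U) t)) h2).trans ?_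
  refine (congrArg (res _ (h'.trans (g.preimage_mono h))) (h3 _)).trans ?_
  exact res_pull (g ≫ f) le_rfl _ s

end PullbackGenerator

/-! ### The ideal of an inverse image subscheme on affine open subsets. -/

section ComapIdeal

variable {X Y : Scheme.{0}}

theorem appRing_comp {Z : Scheme.{0}} (f : Y ⟶ X) (g : Z ⟶ Y) {U : X.Opens} {V : Y.Opens}
    {W : Z.Opens} (h : V ≤ f ⁻¹ᵁ U) (h' : W ≤ g ⁻¹ᵁ V) (h'' : W ≤ (g ≫ f) ⁻¹ᵁ U) :
    (appRing g h').comp (appRing f h) = appRing (g ≫ f) h'' := by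
  rw [← CommRingCat.hom_comp, Scheme.Hom.appLE_comp_appLE]

theorem appRing_congr {f g : Y ⟶ X} (hfg : f = g) {U : X.Opens} {V : Y.Opens} (h : V ≤ f ⁻¹ᵁ U)
    (h' : V ≤ g ⁻¹ᵁ U) : appRing f h = appRing g h' := by
  subst hfg; rfl

variable (X) in
/-- The affine open subset `⊤` of an affine scheme. -/
def topAffine [IsAffine X] : X.affineOpens := ⟨⊤, isAffineOpen_top X⟩

theorem ideal_map_top [IsAffine X] [IsAffine Y] (f : Y ⟶ X) (J : Y.IdealSheafData) :
    (J.map f).ideal (topAffine X) =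
      (J.ideal (topAffine Y)).comap (appRing f (le_refl (f ⁻¹ᵁ (topAffine X).1))) := by
  refine (J.ideal_map_of_isAffineHom f _).trans ?_
  congr 1
  ext a
  exact app_eq_appRing f a

/-- Inverse and direct image of ideal sheaves form a Galois connection. On affine schemes the direct
image is contraction, and ideal sheaves are ideals, so the inverse image must be extension of
ideals. -/
theorem ideal_comap_top [IsAffine X] [IsAffine Y] (f : Y ⟶ X) (I : X.IdealSheafData)
    (h : (topAffine Y).1 ≤ f ⁻¹ᵁ (topAffine X).1) :
    (I.comap f).ideal (topAffine Y) = (I.ideal (topAffine X)).map (appRing f h) := by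
  apply le_antisymm
  · obtain ⟨J, hJ⟩ : ∃ J : Y.IdealSheafData, J.ideal (topAffine Y) =
        (I.ideal (topAffine X)).map (appRing f h) :=
      ⟨Scheme.IdealSheafData.equivOfIsAffine.symm _,
        (Scheme.IdealSheafData.equivOfIsAffine (X := Y)).apply_symm_apply _⟩
    rw [← hJ]
    refine Scheme.IdealSheafData.ideal_mono ?_ _
    rw [← Scheme.IdealSheafData.le_map_iff_comap_le]
    refine Scheme.IdealSheafData.le_of_isAffine (le_trans ?_ (ideal_map_top f J).ge)
    rw [hJ]
    exact Ideal.le_comap_map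
  · refine Ideal.map_le_iff_le_comap.2 (le_trans ?_ (ideal_map_top f _).le)
    exact Scheme.IdealSheafData.ideal_mono (I.le_map_comap f) _

/-- Restriction of functions to an affine open subset, as global functions of the latter. -/
abbrev ιRing (U : X.affineOpens) [IsAffine U.1.toScheme] :
    Γ(X, U) →+* Γ(U.1.toScheme, (topAffine U.1.toScheme).1) :=
  appRing U.1.ι (by simp)

theorem bijective_ιRing (U : X.affineOpens) [IsAffine U.1.toScheme] :
    Function.Bijective (ιRing U) := by
  have h : U.1.ι.appLE U.1 (topAffine U.1.toScheme).1 (by simp) = U.1.topIso.inv := by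
    rw [Scheme.Opens.ι_appLE]
    rfl
  have := ConcreteCategory.bijective_of_isIso U.1.topIso.inv
  rw [← h] at this
  exact this

theorem ideal_comap_ι (U : X.affineOpens) [IsAffine U.1.toScheme] (I : X.IdealSheafData) :
    (I.comap U.1.ι).ideal (topAffine U.1.toScheme) = (I.ideal U).map (ιRing U) := by
  refine (I.ideal_comap_of_isOpenImmersion U.1.ι _).trans ?_
  have h1 : U.1.ι ''ᵁ (topAffine U.1.toScheme).1 ≤ U.1 := U.1.ι_image_le _
  have h2 := I.map_ideal (U := ⟨U.1.ι ''ᵁ (topAffine U.1.toScheme).1,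
    (topAffine U.1.toScheme).2.image_of_isOpenImmersion U.1.ι⟩) (V := U) h1
  have h3 : ιRing U = resRing h1 := by
    rw [ιRing, appRing, Scheme.Opens.ι_appLE]
    rfl
  rw [h3]
  refine Eq.trans ?_ h2.symm
  rw [Scheme.Opens.ι_appIso]
  exact Ideal.comap_id _

/-- Restriction to U and V reduces this to the case of affine schemes; functions on V are identified
with global functions of the scheme V by `ιRing`, and the result is carried back along this
bijection. -/
theorem ideal_comap (f : Y ⟶ X) (I : X.IdealSheafData) (U : X.affineOpens) (V : Y.affineOpens)
    (h : V.1 ≤ f ⁻¹ᵁ U.1) : (I.comap f).ideal V = (I.ideal U).map (appRing f h) := by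
  have : IsAffine U.1.toScheme := U.2
  have : IsAffine V.1.toScheme := V.2
  have h1 : (I.comap f).comap V.1.ι = (I.comap U.1.ι).comap (f.resLE U.1 V.1 h) := by
    rw [← Scheme.IdealSheafData.comap_comp, ← Scheme.IdealSheafData.comap_comp,
      Scheme.Hom.resLE_comp_ι]
  have h2 := congr(($h1).ideal (topAffine V.1.toScheme))
  replace h2 := ((ideal_comap_ι V (I.comap f)).symm.trans h2).trans
    ((ideal_comap_top (f.resLE U.1 V.1 h) (I.comap U.1.ι) le_rfl).trans
      ((congrArg (Ideal.map _) (ideal_comap_ι U I)).trans (Ideal.map_map _ _)))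
  have h3 : (appRing (f.resLE U.1 V.1 h) (le_refl (topAffine V.1.toScheme).1)).comp (ιRing U) =
      (ιRing V).comp (appRing f h) := by
    have h4 := Scheme.Hom.resLE_comp_ι f h
    have h5 : (topAffine V.1.toScheme).1 ≤ (V.1.ι ≫ f) ⁻¹ᵁ U.1 :=
      (show (topAffine V.1.toScheme).1 ≤ V.1.ι ⁻¹ᵁ V.1 by simp).trans (V.1.ι.preimage_mono h)
    have h6 : (topAffine V.1.toScheme).1 ≤ (f.resLE U.1 V.1 h ≫ U.1.ι) ⁻¹ᵁ U.1 := by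
      rw [h4]; exact h5
    exact (appRing_comp _ _ _ _ h6).trans
      ((appRing_congr h4 h6 h5).trans (appRing_comp f V.1.ι h _ h5).symm)
  have h4 := h2.trans ((congrArg (fun φ => Ideal.map φ (I.ideal U)) h3).trans
    (Ideal.map_map _ _).symm)
  exact (Ideal.comap_map_of_bijective _ (bijective_ιRing V)).symm.trans
    ((congrArg (Ideal.comap (ιRing V)) h4).trans
      (Ideal.comap_map_of_bijective _ (bijective_ιRing V)))

end ComapIdeal

/-! ### The image of F in the pull-back of L. -/

section PullbackImage

variable {R : Type} [CommRing R] {X Y : Scheme.{0}} (π : X ⟶ Spec (.of R)) {L : X.Modules}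
  (F : Submodule R (DirectImage π L)) (P : Y ⟶ X)

theorem le_preimage_top (V : Y.Opens) : V ≤ P ⁻¹ᵁ (⊤ : X.Opens) := fun _ _ => trivial

/-- The sections of `P^*L` on `V` generated by the pull-backs of the elements of `F`. -/
def pulledSections (V : Y.Opens) : Submodule Γ(Y, V) Γ((Scheme.Modules.pullback P).obj L, V) :=
  Submodule.span _ {t | ∃ s : DirectImage π L, s ∈ F ∧
    t = pull P L (le_preimage_top P V) (show Γ(L, ⊤) from s)}

theorem LocallyGenerated.exists_affine (hL : LocallyGenerated L) (x : X) :
    ∃ (U : X.affineOpens) (e : Γ(L, U.1)), x ∈ U.1 ∧ IsGenerator L U.1 e := by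
  obtain ⟨W, e, hx, he⟩ := hL x
  obtain ⟨_, ⟨U, hU, rfl⟩, hxU, hUW⟩ := X.isBasis_affineOpens.exists_subset_of_mem_open hx W.2
  exact ⟨⟨U, hU⟩, res L hUW e, hxU, he.restrict _⟩

theorem smul_mem_span_image {A B M N : Type*} [CommRing A] [CommRing B] [AddCommGroup M]
    [AddCommGroup N] [Module A M] [Module B N] {ρ : A →+* B} (r : M →ₛₗ[ρ] N) {J : Ideal A}
    {b : B} (hb : b ∈ J.map ρ) {G : Submodule A M} {n : N}
    (hn : n ∈ Submodule.span B (r '' G)) : b • n ∈ Submodule.span B (r '' (J • G : Submodule A M)) := by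
  induction hn using Submodule.span_induction with
  | mem n hn =>
    obtain ⟨m, hm, rfl⟩ := hn
    rw [Ideal.map] at hb
    induction hb using Submodule.span_induction with
    | mem b hb =>
      obtain ⟨a, ha, rfl⟩ := hb
      rw [← map_smulₛₗ]
      exact Submodule.subset_span ⟨_, Submodule.smul_mem_smul ha hm, rfl⟩
    | zero => rw [zero_smul]; exact zero_mem _
    | add b c _ _ hb hc => rw [add_smul]; exact add_mem hb hc
    | smul c b _ hb => rw [smul_assoc]; exact Submodule.smul_mem _ _ hb
  | zero => rw [smul_zero]; exact zero_mem _
  | add n n' _ _ h h' => rw [smul_add]; exact add_mem h h'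
  | smul c n _ h => rw [smul_comm]; exact Submodule.smul_mem _ _ h

theorem map_mem_span_image {A B M N : Type*} [CommRing A] [CommRing B]
    [AddCommGroup M] [AddCommGroup N] [Module A M] [Module B N]
    {ρ : A →+* B} (r : M →ₛₗ[ρ] N) (S : Set M) (T : Submodule B N)
    (h : ∀ s ∈ S, r s ∈ T) {m : M} (hm : m ∈ Submodule.span A S) : r m ∈ T := by
  induction hm using Submodule.span_induction with
  | mem m hm => exact h m hm
  | zero => rw [map_zero]; exact zero_mem _
  | add m m' _ _ h h' => rw [map_add]; exact add_mem h h'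
  | smul a m _ h => rw [map_smulₛₗ]; exact Submodule.smul_mem _ _ h

variable {P}

theorem pull_mem_pulledSections {U : X.Opens} {V : Y.Opens} (h : V ≤ P ⁻¹ᵁ U) {t : Γ(L, U)}
    (ht : t ∈ generatedSections π L F U) : pull P L h t ∈ pulledSections π F P V := by
  refine map_mem_span_image (pull P L h) {t | ∃ s : DirectImage π L, s ∈ F ∧
    t = L.presheaf.map (homOfLE le_top : U ⟶ ⊤).op s} (pulledSections π F P V) ?_ ht
  rintro _ ⟨s, hs, rfl⟩
  refine Submodule.subset_span ⟨s, hs, ?_⟩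
  exact pull_res P h le_top _

theorem pulledSections_le_span_image {V W : Y.Opens} (h : W ≤ V) :
    pulledSections π F P W ≤ Submodule.span Γ(Y, W) (res _ h '' pulledSections π F P V) := by
  refine Submodule.span_mono ?_
  rintro _ ⟨s, hs, rfl⟩
  exact ⟨_, Submodule.subset_span ⟨s, hs, rfl⟩, res_pull P _ h _⟩

theorem pull_mem_span_image (hL : LocallyGenerated L) {I : X.IdealSheafData} {U : X.affineOpens}
    {V : Y.affineOpens} {f : Γ(Y, V.1)} (h : Y.basicOpen f ≤ P ⁻¹ᵁ U.1) {t : Γ(L, U.1)}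
    (ht : t ∈ I.ideal U • (⊤ : Submodule Γ(X, U) Γ(L, U))) :
    pull P L h t ∈ Submodule.span Γ(Y, Y.basicOpen f) (res _ (Y.basicOpen_le f) ''
      ((I.comap P).ideal V • (⊤ : Submodule Γ(Y, V) Γ((Scheme.Modules.pullback P).obj L, V)) :
        Submodule Γ(Y, V) _)) := by
  refine Submodule.smul_induction_on ht (fun b hb l _ => ?_) fun l l' h h' => ?_
  · rw [pull_smul]
    refine smul_mem_span_image _ ?_ ?_
    · exact (((I.comap P).map_ideal_basicOpen V f).trans
        (ideal_comap P I U (Y.affineBasicOpen f) h)).ge (Ideal.mem_map_of_mem _ hb)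
    · rw [((hL.pullback P).localizesAt V.2 f).span_image_top]
      trivial
  · rw [map_add]
    exact add_mem h h'

theorem smul_mem_pulledSections {I : X.IdealSheafData} {U : X.affineOpens}
    (hI : I.ideal U • (⊤ : Submodule Γ(X, U) Γ(L, U)) ≤ generatedSections π L F U)
    {e : Γ(L, U.1)} (he : IsGenerator L U.1 e) {V : Y.Opens} (h : V ≤ P ⁻¹ᵁ U.1)
    {b : Γ(Y, V)} (hb : b ∈ (I.ideal U).map (appRing P h))
    (m : Γ((Scheme.Modules.pullback P).obj L, V)) : b • m ∈ pulledSections π F P V := by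
  obtain ⟨c, rfl⟩ := (he.pullback P h).exists_smul m
  rw [smul_comm]
  refine Submodule.smul_mem _ _ ?_
  rw [Ideal.map] at hb
  induction hb using Submodule.span_induction with
  | mem b hb =>
    obtain ⟨a, ha, rfl⟩ := hb
    rw [← pull_smul]
    exact pull_mem_pulledSections π F h (hI (Submodule.smul_mem_smul ha trivial))
  | zero => rw [zero_smul]; exact zero_mem _
  | add b c _ _ hb hc => rw [add_smul]; exact add_mem hb hc
  | smul c b _ hb => rw [smul_assoc]; exact Submodule.smul_mem _ _ hb

theorem LocallyGenerated.exists_affine_basicOpen (hL : LocallyGenerated L) (P : Y ⟶ X)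
    {V : Y.Opens} (hV : IsAffineOpen V) {y : Y} (hy : y ∈ V) :
    ∃ (U : X.affineOpens) (e : Γ(L, U.1)) (f : Γ(Y, V)),
      IsGenerator L U.1 e ∧ y ∈ Y.basicOpen f ∧ Y.basicOpen f ≤ P ⁻¹ᵁ U.1 := by
  obtain ⟨U, e, hxU, he⟩ := hL.exists_affine (P y)
  obtain ⟨f, hf, hyf⟩ := hV.exists_basicOpen_le (V := P ⁻¹ᵁ U.1) ⟨y, hxU⟩ hy
  exact ⟨U, e, f, he, hyf, hf⟩

/-- Both sides are submodules of the sections on an affine V, so inclusions can be checked on basic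
open subsets mapping into an affine U where L has a basis. There one inclusion pulls back a section
of I · L, and the other writes a section as a multiple of the pulled back basis. -/
theorem pulledSections_eq (hL : LocallyGenerated L) (I : X.IdealSheafData)
    (hI : ∀ U : X.affineOpens, I.ideal U • (⊤ : Submodule Γ(X, U) Γ(L, U)) =
      generatedSections π L F U) (V : Y.affineOpens) :
    pulledSections π F P V.1 = (I.comap P).ideal V • (⊤ : Submodule Γ(Y, V) _) := by
  apply le_antisymm
  · rw [pulledSections, Submodule.span_le]
    rintro _ ⟨s, hs, rfl⟩
    refine (hL.pullback P).mem_of_locally V.2 _ _ fun y hy => ?_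
    obtain ⟨U, e, f, he, hyf, hfU⟩ := hL.exists_affine_basicOpen P V.2 hy
    refine ⟨f, hyf, ?_⟩
    rw [res_pull, ← pull_res P hfU le_top]
    refine pull_mem_span_image hL hfU ?_
    rw [hI]
    exact Submodule.subset_span ⟨s, hs, rfl⟩
  · rw [Submodule.smul_le]
    intro b hb m _
    refine (hL.pullback P).mem_of_locally V.2 _ _ fun y hy => ?_
    obtain ⟨U, e, f, he, hyf, hfU⟩ := hL.exists_affine_basicOpen P V.2 hy
    refine ⟨f, hyf, pulledSections_le_span_image π F (Y.basicOpen_le f) ?_⟩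
    rw [res_smul]
    refine smul_mem_pulledSections π F (hI U).le he hfU ?_ _
    exact (((I.comap P).map_ideal_basicOpen V f).trans
      (ideal_comap P I U (Y.affineBasicOpen f) hfU)).le (Ideal.mem_map_of_mem _ hb)

/-- Near P(y) a local basis is generated by F. If F pulled back to zero, so would this basis; but
its pull-back is again a basis, on a nonempty open subset of an integral scheme. -/
theorem pulledSections_ne_bot [IsIntegral Y] (hL : LocallyGenerated L) {y : Y}
    (h : GeneratesAt π L F (P y)) : pulledSections π F P ⊤ ≠ ⊥ := by
  obtain ⟨U, e, hxU, he⟩ := hL (P y)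
  obtain ⟨V, hVU, hxV, hV⟩ := h U hxU e
  intro H
  have h1 := pulledSections_le_span_image π F (le_top : P ⁻¹ᵁ V ≤ ⊤)
    (pull_mem_pulledSections π F (le_refl (P ⁻¹ᵁ V)) hV)
  rw [H, Submodule.bot_coe, Set.image_singleton, map_zero, Submodule.span_zero_singleton,
    Submodule.mem_bot] at h1
  have h2 := (he.restrict hVU).pullback P (le_refl (P ⁻¹ᵁ V))
  have h3 : (1 : Γ(Y, P ⁻¹ᵁ V)) = 0 := h2.eq_zero ((one_smul _ _).trans h1)
  have : Nonempty (P ⁻¹ᵁ V) := ⟨⟨y, hxV⟩⟩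
  exact one_ne_zero h3

end PullbackImage

/-! ### Line bundles on integral schemes: torsion-freeness and rank one. -/

section Integral

theorem LocallyGenerated.exists_generator {X : Scheme.{0}} {L : X.Modules} (hL : LocallyGenerated L) (U : X.Opens) [Nonempty U] :
    ∃ (V : X.Opens) (e : Γ(L, V)), Nonempty V ∧ V ≤ U ∧ IsGenerator L V e := by
  obtain ⟨x⟩ := ‹Nonempty U›
  obtain ⟨W, e, hx, he⟩ := hL x.1
  exact ⟨W ⊓ U, _, ⟨⟨x.1, hx, x.2⟩⟩, inf_le_right, he.restrict inf_le_left⟩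

variable {X : Scheme.{0}} [IsIntegral X] {L : X.Modules} {U V : X.Opens}

theorem resRing_injective (h : V ≤ U) [Nonempty V] : Function.Injective (resRing h) :=
  map_injective_of_isIntegral X (homOfLE h)

/-- In local coordinates this is injectivity for functions, since by irreducibility V meets each
nonempty member of a trivializing cover. -/
theorem LocallyGenerated.res_injective (hL : LocallyGenerated L) (h : V ≤ U) [Nonempty V] :
    Function.Injective (res L h) := by
  rw [injective_iff_map_eq_zero]
  intro m hm
  choose W e hW he using hL
  refine res_ext (fun x : U => W x ⊓ U) (fun _ => inf_le_right)
    (fun x hx => TopologicalSpace.Opens.mem_iSup.2 ⟨⟨x, hx⟩, hW x, hx⟩) fun x => ?_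
  obtain ⟨a, ha⟩ := ((he x).restrict (inf_le_left : W x ⊓ U ≤ _)).exists_smul
    (res L inf_le_right m)
  have : Nonempty (W x ⊓ U ⊓ V : X.Opens) := by
    obtain ⟨v⟩ := ‹Nonempty V›
    obtain ⟨z, hz⟩ := nonempty_preirreducible_inter (W x ⊓ U).2 V.2 ⟨x.1, hW x, x.2⟩ ⟨v.1, v.2⟩
    exact ⟨z, hz⟩
  have h1 := congr(res L (inf_le_left : W x ⊓ U ⊓ V ≤ _) $ha)
  rw [res_smul, res_res, res_res] at h1
  have h2 : res L (inf_le_left.trans inf_le_right : W x ⊓ U ⊓ V ≤ U) m = 0 := by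
    rw [← res_res h inf_le_right, hm, map_zero]
  have h3 := ((he x).restrict (inf_le_left.trans inf_le_left : W x ⊓ U ⊓ V ≤ W x)).eq_zero
    (h1.trans h2)
  have h4 : a = 0 := resRing_injective (inf_le_left : W x ⊓ U ⊓ V ≤ _) (h3.trans (map_zero _).symm)
  rw [← ha, h4, zero_smul, map_zero]

theorem LocallyGenerated.smul_eq_zero (hL : LocallyGenerated L) [Nonempty U] {a : Γ(X, U)}
    {m : Γ(L, U)} (h : a • m = 0) : a = 0 ∨ m = 0 := by
  obtain ⟨V, e, hV, hVU, he⟩ := hL.exists_generator U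
  obtain ⟨c, hc⟩ := he.exists_smul (res L hVU m)
  have h1 := congr(res L hVU $h)
  rw [res_smul, map_zero, ← hc, smul_smul] at h1
  rcases mul_eq_zero.1 (he.eq_zero h1) with h2 | h2
  · exact Or.inl (resRing_injective hVU (h2.trans (map_zero _).symm))
  · refine Or.inr (hL.res_injective hVU ?_)
    rw [← hc, h2, zero_smul, map_zero]

/-- The sections of a line bundle have rank at most one. -/
theorem LocallyGenerated.exists_smul_eq_smul (hL : LocallyGenerated L) (hU : IsAffineOpen U)
    [Nonempty U] {m₀ : Γ(L, U)} (h₀ : m₀ ≠ 0) (m : Γ(L, U)) :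
    ∃ a b : Γ(X, U), a ≠ 0 ∧ a • m = b • m₀ := by
  obtain ⟨x⟩ := ‹Nonempty U›
  obtain ⟨f, e, hxf, -, he⟩ := hL.exists_basicOpen hU (V := U) x.2 x.2
  have : Nonempty (X.basicOpen f) := ⟨⟨x.1, hxf⟩⟩
  have hl := hL.localizesAt hU f
  obtain ⟨c, hc⟩ := he.exists_smul (res L (X.basicOpen_le f) m)
  obtain ⟨c₀, hc₀⟩ := he.exists_smul (res L (X.basicOpen_le f) m₀)
  obtain ⟨n, b, hb⟩ := hl.ring_surj c
  obtain ⟨k, b₀, hb₀⟩ := hl.ring_surj c₀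
  -- If m = c e and m₀ = c₀ e on the basic open subset, then c₀ m = c m₀ there; the powers of f
  -- clear the denominators of c and c₀.
  refine ⟨f ^ n * b₀, f ^ k * b, ?_, hL.res_injective (X.basicOpen_le f) ?_⟩
  · intro h
    have h1 := congr(resRing (X.basicOpen_le f) $h)
    rw [map_mul, map_zero, map_pow, hb₀] at h1
    have h2 : c₀ = 0 := (hl.isUnit.pow k).mul_right_eq_zero.1
      ((hl.isUnit.pow n).mul_right_eq_zero.1 h1)
    refine h₀ (hL.res_injective (X.basicOpen_le f) ?_)
    rw [← hc₀, h2, zero_smul, map_zero]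
  · rw [res_smul, res_smul, map_mul, map_mul, hb, hb₀, ← hc, ← hc₀, smul_smul, smul_smul,
      map_pow, map_pow]
    congr 1
    ring

end Integral

/-! ### Global sections on Spec A as an A-module. -/

section AffineSections

variable {A : Type} [CommRing A] {N : (Spec (.of A)).Modules}

/-- The isomorphism of `A` with the ring of functions on `Spec A`. -/
def toFunctions (A : Type) [CommRing A] : A ≃+* Γ(Spec (.of A), ⊤) :=
  (Scheme.ΓSpecIso (.of A)).symm.commRingCatIsoToRingEquiv

/-- A global section, as a section on `⊤`. -/
def toSection : GlobalSections N ≃+ Γ(N, ⊤) := AddEquiv.refl _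

theorem toSection_smul (a : A) (s : GlobalSections N) :
    toSection (a • s) = toFunctions A a • toSection s := smul_globalSections N a s

/-- An `A`-submodule of the module of global sections, as a module over the ring of functions. -/
def functionSubmodule (G : Submodule A (GlobalSections N)) :
    Submodule Γ(Spec (.of A), ⊤) Γ(N, ⊤) where
  carrier := {t | toSection.symm t ∈ G}
  add_mem' h h' := G.add_mem h h'
  zero_mem' := G.zero_mem
  smul_mem' a t h := by
    obtain ⟨a, rfl⟩ := (toFunctions A).surjective a
    obtain ⟨t, rfl⟩ := toSection.surjective t
    rw [← toSection_smul]
    exact G.smul_mem a h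

theorem mem_functionSubmodule {G : Submodule A (GlobalSections N)} {t : GlobalSections N} :
    toSection t ∈ functionSubmodule G ↔ t ∈ G := Iff.rfl

theorem LocallyGenerated.finite_globalSections (hN : LocallyGenerated N) :
    Module.Finite A (GlobalSections N) := by
  classical
  obtain ⟨S, hS⟩ := (hN.locallyCyclic (isAffineOpen_top _)).finite.fg_top
  refine ⟨⟨(S.image (toSection (N := N)).symm : Finset (GlobalSections N)), ?_⟩⟩
  rw [eq_top_iff]
  rintro m -
  have h : Submodule.span Γ(Spec (.of A), ⊤) (S : Set Γ(N, ⊤)) ≤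
      functionSubmodule (Submodule.span A
        ((S.image (toSection (N := N)).symm : Finset (GlobalSections N)) :
          Set (GlobalSections N))) :=
    Submodule.span_le.2 fun s hs => (mem_functionSubmodule (t := toSection.symm s)).2
      (Submodule.subset_span (Finset.mem_coe.2 (Finset.mem_image_of_mem _ hs)))
  exact h (hS ▸ trivial : toSection m ∈ _)

instance [IsDomain A] : Nonempty (⊤ : (Spec (.of A)).Opens) :=
  ⟨⟨(⊥ : PrimeSpectrum A), trivial⟩⟩

theorem LocallyGenerated.globalSections_smul_eq_zero [IsDomain A] (hN : LocallyGenerated N)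
    {a : A} {m : GlobalSections N} (h : a • m = 0) : a = 0 ∨ m = 0 := by
  have h1 := congr(toSection $h)
  rw [toSection_smul, map_zero] at h1
  exact (hN.smul_eq_zero h1).imp (fun h => (toFunctions A).injective (h.trans (map_zero _).symm))
    fun h => toSection.injective (h.trans (map_zero _).symm)

theorem LocallyGenerated.globalSections_exists_smul_eq_smul [IsDomain A] (hN : LocallyGenerated N)
    {m₀ : GlobalSections N} (h₀ : m₀ ≠ 0) (m : GlobalSections N) :
    ∃ a b : A, a ≠ 0 ∧ a • m = b • m₀ := by
  obtain ⟨a, b, ha, h⟩ := hN.exists_smul_eq_smul (isAffineOpen_top _)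
    (m₀ := toSection m₀) (fun h => h₀ (toSection.injective (h.trans (map_zero _).symm)))
    (toSection m)
  obtain ⟨a, rfl⟩ := (toFunctions A).surjective a
  obtain ⟨b, rfl⟩ := (toFunctions A).surjective b
  exact ⟨a, b, fun h => ha (by rw [h, map_zero]), toSection.injective
    (by rw [toSection_smul, toSection_smul, h])⟩

end AffineSections

/-! ### Restriction of the fibre to points with values in a field. -/

section Restriction

variable {A B : Type} [CommRing A] [CommRing B] {X : Scheme.{0}} {L : X.Modules}

theorem appRing_toFunctions (φ : A →+* B) (a : A) :
    appRing (Spec.map (CommRingCat.ofHom φ)) (le_preimage_top _ ⊤) (toFunctions A a) =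
      toFunctions B (φ a) := by
  have h := congr($(Scheme.ΓSpecIso_inv_naturality (CommRingCat.ofHom φ)) a)
  refine (Eq.trans h ?_).symm
  exact app_eq_appRing (Spec.map (CommRingCat.ofHom φ)) (U := ⊤) (toFunctions A a)

/-- The isomorphism between the iterated pull-back and the pull-back by the composition. -/
abbrev compMap (L : X.Modules) (x : Spec (.of A) ⟶ X) (φ : A →+* B) :=
  (Scheme.Modules.pullbackComp (Spec.map (CommRingCat.ofHom φ)) x).hom.app L

theorem toSection_restrictFibre (x : Spec (.of A) ⟶ X) (φ : A →+* B) (s : Fibre L x) :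
    toSection (restrictFibre L x φ s) = (compMap L x φ).app ⊤
      (pull (Spec.map (CommRingCat.ofHom φ)) _ (le_preimage_top _ ⊤) (toSection s)) := rfl

theorem restrictFibre_add (x : Spec (.of A) ⟶ X) (φ : A →+* B) (s t : Fibre L x) :
    restrictFibre L x φ (s + t) = restrictFibre L x φ s + restrictFibre L x φ t := by
  apply toSection.injective
  rw [map_add, toSection_restrictFibre, toSection_restrictFibre, toSection_restrictFibre,
    map_add, map_add, map_add]

theorem restrictFibre_smul (x : Spec (.of A) ⟶ X) (φ : A →+* B) (a : A) (s : Fibre L x) :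
    restrictFibre L x φ (a • s) = φ a • restrictFibre L x φ s := by
  apply toSection.injective
  rw [toSection_smul, toSection_restrictFibre, toSection_restrictFibre, toSection_smul, pull_smul,
    appRing_toFunctions]
  exact Scheme.Modules.Hom.app_smul _ _ _

theorem restrictFibre_pullbackSection (x : Spec (.of A) ⟶ X) (φ : A →+* B) (s : Γ(L, ⊤)) :
    restrictFibre L x φ (pullbackSection L x ⊤ rfl s) =
      pullbackSection L (Spec.map (CommRingCat.ofHom φ) ≫ x) ⊤ rfl s :=
  pull_pull x (Spec.map (CommRingCat.ofHom φ)) L _ _ s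

/-- As φ is injective, the point of Spec k goes to the generic point of Spec A, which lies in every
nonempty open subset. -/
theorem preimage_eq_top [IsDomain A] {k : Type} [Field k] {φ : A →+* k} (hφ : Function.Injective φ)
    (V : (Spec (.of A)).Opens) [Nonempty V] : Spec.map (CommRingCat.ofHom φ) ⁻¹ᵁ V = ⊤ := by
  rw [eq_top_iff]
  rintro y -
  obtain ⟨v⟩ := ‹Nonempty V›
  have h : (Spec.map (CommRingCat.ofHom φ) y) ⤳ v.1 := by
    refine (PrimeSpectrum.le_iff_specializes (R := A) _ _).1 fun a ha => ?_
    have h1 : φ a ∈ PrimeSpectrum.asIdeal y := ha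
    have h2 : PrimeSpectrum.asIdeal y = ⊥ :=
      (Ideal.eq_bot_or_top _).resolve_right (PrimeSpectrum.isPrime y).ne_top
    rw [h2, Ideal.mem_bot] at h1
    rw [hφ (h1.trans (map_zero φ).symm)]
    exact zero_mem _
  exact h.mem_open V.2 v.2

theorem appRing_ne_zero [IsDomain A] {k : Type} [Field k] {φ : A →+* k}
    (hφ : Function.Injective φ) {V : (Spec (.of A)).Opens}
    (h : ⊤ ≤ Spec.map (CommRingCat.ofHom φ) ⁻¹ᵁ V) {a : Γ(Spec (.of A), V)} (ha : a ≠ 0) :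
    appRing (Spec.map (CommRingCat.ofHom φ)) h a ≠ 0 := by
  intro h0
  have h1 := Scheme.basicOpen_appLE (Spec.map (CommRingCat.ofHom φ)) ⊤ V h a
  have h2 : Nonempty ((Spec (.of A)).basicOpen a) := by
    by_contra H
    refine ha (eq_zero_of_basicOpen_eq_bot a ?_)
    ext y
    exact ⟨fun hy => (H ⟨⟨y, hy⟩⟩).elim, fun hy => hy.elim⟩
  rw [preimage_eq_top hφ, top_inf_eq] at h1
  have h3 : (Spec (.of k)).basicOpen (0 : Γ(Spec (.of k), ⊤)) = ⊤ :=
    (congrArg (fun c => (Spec (.of k)).basicOpen c) h0.symm).trans h1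
  rw [Scheme.basicOpen_zero] at h3
  exact (h3.ge (show (⊥ : PrimeSpectrum k) ∈ _ from trivial) : (⊥ : PrimeSpectrum k) ∈ (⊥ : (Spec (.of k)).Opens))

/-- On a nonempty open subset m = c e with e a basis and c ≠ 0. The basis restricts to a basis at
the point of Spec k, and c to a nonzero scalar because this point lies over the generic one. -/
theorem LocallyGenerated.restrictFibre_ne_zero [IsDomain A] (hL : LocallyGenerated L)
    (x : Spec (.of A) ⟶ X) {k : Type} [Field k] {φ : A →+* k} (hφ : Function.Injective φ)
    {m : Fibre L x} (hm : m ≠ 0) : restrictFibre L x φ m ≠ 0 := by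
  obtain ⟨V, e, hV, -, he⟩ := (hL.pullback x).exists_generator ⊤
  have hV' := (preimage_eq_top hφ V).ge
  obtain ⟨c, hc⟩ := he.exists_smul (res _ le_top (toSection m))
  intro h0
  have h1 := congr(toSection $h0)
  have h2 : Function.Injective ((compMap L x φ).app ⊤) := (bijective_app_hom
    ((Scheme.Modules.pullbackComp (Spec.map (CommRingCat.ofHom φ)) x).app L) ⊤).1
  rw [toSection_restrictFibre, map_zero] at h1
  have h3 := h2 (h1.trans (map_zero _).symm)
  have h4 := pull_res (Spec.map (CommRingCat.ofHom φ)) hV' le_top (toSection m)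
  rw [← hc, pull_smul] at h4
  have h5 := (he.pullback _ hV').eq_zero (h4.trans h3)
  refine appRing_ne_zero hφ hV' ?_ h5
  rintro rfl
  rw [zero_smul] at hc
  exact hm (toSection.injective ((hL.pullback x).res_injective le_top
    (hc.symm.trans (by rw [map_zero, map_zero]))))

/-- Spec k has one point, so a basis near that point is a global one. -/
theorem LocallyGenerated.finrank_fibre (hL : LocallyGenerated L) {k : Type} [Field k]
    (x : Spec (.of k) ⟶ X) : Module.finrank k (Fibre L x) = 1 := by
  obtain ⟨U, e, hxU, he⟩ := hL.pullback x (⊥ : PrimeSpectrum k)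
  have hU : (⊤ : (Spec (.of k)).Opens) ≤ U := by
    rintro y -
    have : y = (⊥ : PrimeSpectrum k) := Subsingleton.elim (α := PrimeSpectrum k) _ _
    rwa [this]
  have he' := he.restrict hU
  refine finrank_eq_one (toSection.symm (res _ hU e)) ?_ ?_
  · intro h
    have h1 : (1 : Γ(Spec (.of k), ⊤)) = 0 :=
      he'.eq_zero ((one_smul _ _).trans (congr(toSection $h) : _))
    refine one_ne_zero ((toFunctions k).injective ?_)
    rw [map_one, map_zero, h1]
  · intro w
    obtain ⟨c, hc⟩ := he'.exists_smul (toSection w)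
    obtain ⟨c, rfl⟩ := (toFunctions k).surjective c
    exact ⟨c, toSection.injective hc⟩

end Restriction

/-! ### The evaluation map along the section P, its image and its base changes. -/

section SectionEvaluation

variable {A : Type} [CommRing A] {N : (Spec (.of A)).Modules}

theorem functionSubmodule_smul_top (J : Ideal Γ(Spec (.of A), ⊤)) :
    functionSubmodule (J.comap (toFunctions A) • (⊤ : Submodule A (GlobalSections N))) =
      J • (⊤ : Submodule Γ(Spec (.of A), ⊤) Γ(N, ⊤)) := by
  apply le_antisymm
  · have key : ∀ t ∈ J.comap (toFunctions A) • (⊤ : Submodule A (GlobalSections N)),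
        toSection t ∈ J • (⊤ : Submodule Γ(Spec (.of A), ⊤) Γ(N, ⊤)) := by
      intro t ht
      induction ht using Submodule.smul_induction_on' with
      | smul a ha m _ =>
        rw [toSection_smul]
        exact Submodule.smul_mem_smul ha trivial
      | add m _ m' _ h h' =>
        rw [map_add]
        exact add_mem h h'
    exact fun t ht => key (toSection.symm t) ht
  · rw [Submodule.smul_le]
    intro a ha t _
    obtain ⟨a, rfl⟩ := (toFunctions A).surjective a
    obtain ⟨t, rfl⟩ := toSection.surjective t
    rw [← toSection_smul, mem_functionSubmodule]
    exact Submodule.smul_mem_smul ha trivial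

theorem functionSubmodule_injective :
    Function.Injective (functionSubmodule (A := A) (N := N)) := fun G H h =>
  Submodule.ext fun t => by rw [← mem_functionSubmodule, h, mem_functionSubmodule]

variable {R : Type} [CommRing R] {X : Scheme.{0}} (π : X ⟶ Spec (.of R)) {L : X.Modules}
  (F : Submodule R (DirectImage π L)) (P : Spec (.of R) ⟶ X) (hP : P ≫ π = 𝟙 _)

variable {π P} in
theorem section_comp (hP : P ≫ π = 𝟙 _) : P ≫ π = Spec.map (CommRingCat.ofHom (algebraMap R R)) :=
  hP.trans (Spec.map_id _).symm

/-- The evaluation map `F ⟶ P^*L` at a section `P` of `π`. -/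
def sectionEvaluation : F →ₗ[R] Fibre L P where
  toFun s := pullbackSection L P ⊤ rfl (s : DirectImage π L)
  map_add' s t := pullbackSection_add L P (s : DirectImage π L) (t : DirectImage π L)
  map_smul' r s := pullbackSection_smul π L P (section_comp hP) r s

theorem functionSubmodule_range_sectionEvaluation :
    functionSubmodule (LinearMap.range (sectionEvaluation π F P hP)) = pulledSections π F P ⊤ := by
  apply le_antisymm
  · rintro t ⟨s, hs⟩
    exact Submodule.subset_span ⟨s, s.2, congr(toSection $hs).symm⟩
  · rw [pulledSections, Submodule.span_le]
    rintro _ ⟨s, hs, rfl⟩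
    exact ⟨⟨s, hs⟩, rfl⟩

/-- This is `pulledSections_eq` on the affine scheme Spec R itself, translated from modules over its
functions to R-modules. -/
theorem range_sectionEvaluation (hL : IsLineBundle L) :
    LinearMap.range (sectionEvaluation π F P hP) =
      pullbackIdeal (baseIdeal π L F) P • (⊤ : Submodule R (Fibre L P)) := by
  apply functionSubmodule_injective
  rw [functionSubmodule_range_sectionEvaluation]
  refine (pulledSections_eq π F hL.locallyGenerated _ (baseIdeal_smul_top π F hL.locallyGenerated)
    ⟨⊤, isAffineOpen_top _⟩).trans ?_
  exact (functionSubmodule_smul_top (N := (Scheme.Modules.pullback P).obj L) _).symm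

/-- P sends the generic point of Spec R to a point of the generic fibre of π, where F generates L.
-/
theorem sectionEvaluation_ne_zero [IsDomain R] (hL : IsLineBundle L)
    (hgen : ∀ x : X, (π x).asIdeal = ⊥ → GeneratesAt π L F x) :
    sectionEvaluation π F P hP ≠ 0 := by
  intro h
  have h1 : π (P (⊥ : PrimeSpectrum R)) = (⊥ : PrimeSpectrum R) := by
    have := congr($hP (⊥ : PrimeSpectrum R))
    exact this
  refine pulledSections_ne_bot π F hL.locallyGenerated (hgen _ congr(PrimeSpectrum.asIdeal $h1)) ?_
  rw [← functionSubmodule_range_sectionEvaluation π F P hP, h, LinearMap.range_zero, eq_bot_iff]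
  exact fun t ht => ht

theorem pullbackIdeal_baseIdeal_ne_bot [IsDomain R] (hP : P ≫ π = 𝟙 _) (hL : IsLineBundle L)
    (hgen : ∀ x : X, (π x).asIdeal = ⊥ → GeneratesAt π L F x) :
    pullbackIdeal (baseIdeal π L F) P ≠ ⊥ := by
  intro h
  have h1 := range_sectionEvaluation π F P hP hL
  rw [h, Submodule.bot_smul, LinearMap.range_eq_bot] at h1
  exact sectionEvaluation_ne_zero π F P hP hL hgen h1

variable {P}

theorem evaluation_tmul [Algebra R A] (x : Spec (.of A) ⟶ X)
    (hx : x ≫ π = Spec.map (CommRingCat.ofHom (algebraMap R A))) (a : A) (s : F) :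
    evaluation π L F x hx (a ⊗ₜ s) = a • pullbackSection L x ⊤ rfl (s : DirectImage π L) := by
  let : Module R (Fibre L x) := Module.compHom _ (algebraMap R A)
  have : IsScalarTower R A (Fibre L x) := IsScalarTower.of_algebraMap_smul fun _ _ => rfl
  exact LinearMap.liftBaseChange_tmul ..

variable (L P) in
/-- The map `restrictFibre`, as a semilinear map. -/
def restriction {B : Type} [CommRing B] (φ : R →+* B) :
    Fibre L P →ₛₗ[φ] Fibre L (Spec.map (CommRingCat.ofHom φ) ≫ P) where
  toFun := restrictFibre L P φ
  map_add' := restrictFibre_add P φ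
  map_smul' := restrictFibre_smul P φ

theorem evaluation_tmul_eq_restriction [Algebra R A]
    (hx : (Spec.map (CommRingCat.ofHom (algebraMap R A)) ≫ P) ≫ π =
      Spec.map (CommRingCat.ofHom (algebraMap R A))) (a : A) (s : F) :
    evaluation π L F (Spec.map (CommRingCat.ofHom (algebraMap R A)) ≫ P) hx (a ⊗ₜ s) =
      a • restriction L P (algebraMap R A) (sectionEvaluation π F P hP s) := by
  rw [evaluation_tmul]
  exact congrArg (a • ·) (restrictFibre_pullbackSection P (algebraMap R A) _).symm

end SectionEvaluation

/-! ### Embedding a rank one module in the ring. -/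

section RankOne

variable {R M : Type*} [CommRing R] [IsDomain R] [AddCommGroup M] [Module R M]

/-- A finitely generated torsion-free module of rank one is isomorphic to an ideal. -/
theorem exists_injective_linearMap [Module.Finite R M]
    (htf : ∀ (a : R) (m : M), a • m = 0 → a = 0 ∨ m = 0) {m₀ : M} (h₀ : m₀ ≠ 0)
    (hrk : ∀ m : M, ∃ a b : R, a ≠ 0 ∧ a • m = b • m₀) :
    ∃ φ : M →ₗ[R] R, Function.Injective φ := by
  obtain ⟨S, hS⟩ := Module.Finite.fg_top (R := R) (M := M)
  choose a b ha hab using hrk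
  -- A common denominator: c M is contained in R m₀, and φ(m) is the coefficient of c m on m₀.
  set c := ∏ m ∈ S, a m with hc
  have hc0 : c ≠ 0 := Finset.prod_ne_zero_iff.2 fun m _ => ha m
  have h (m : M) : ∃ r : R, c • m = r • m₀ := by
    have hm : m ∈ Submodule.span R (S : Set M) := hS ▸ trivial
    induction hm using Submodule.span_induction with
    | mem m hm =>
      obtain ⟨d, hd⟩ := Finset.dvd_prod_of_mem a hm
      exact ⟨d * b m, by rw [hc, hd, mul_comm, mul_smul, hab, mul_smul]⟩
    | zero => exact ⟨0, by simp⟩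
    | add m m' _ _ h h' =>
      obtain ⟨r, hr⟩ := h
      obtain ⟨r', hr'⟩ := h'
      exact ⟨r + r', by rw [smul_add, hr, hr', add_smul]⟩
    | smul d m _ h =>
      obtain ⟨r, hr⟩ := h
      exact ⟨d * r, by rw [smul_comm, hr, mul_smul]⟩
  choose r hr using h
  have hinj {x y : R} (hxy : x • m₀ = y • m₀) : x = y := by
    rw [← sub_eq_zero, ← sub_smul] at hxy
    exact sub_eq_zero.1 ((htf _ _ hxy).resolve_right h₀)
  refine ⟨⟨⟨r, fun m m' => hinj ?_⟩, fun x m => hinj ?_⟩, ?_⟩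
  · rw [← hr, smul_add, hr, hr, add_smul]
  · rw [← hr, smul_comm, hr, smul_smul]; rfl
  · rw [injective_iff_map_eq_zero]
    intro m (hm : r m = 0)
    exact (htf c m (by rw [hr, hm, zero_smul])).resolve_left hc0

end RankOne

/-! ### Arakelov degree and ideal norms. -/

section Degree

variable {K : Type} [Field K] [NumberField K]

theorem intEmbedding_injective {K : Type} [Field K] (σ : K →+* ℂ) : Function.Injective (intEmbedding σ) :=
  σ.injective.comp (FaithfulSMul.algebraMap_injective (𝓞 K) K)

theorem absNorm_span_eq_prod (x : 𝓞 K) :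
    (Ideal.absNorm (Ideal.span {x}) : ℝ) = ∏ σ : K →+* ℂ, ‖intEmbedding σ x‖ := by
  have h := Algebra.norm_eq_prod_embeddings ℚ ℂ (x : K)
  have h1 : (∏ σ : K →ₐ[ℚ] ℂ, σ (x : K)) = ∏ σ : K →+* ℂ, σ (x : K) :=
    (Fintype.prod_equiv (RingHom.equivRatAlgHom (R := K) (S := ℂ)) _ _ fun _ => rfl).symm
  rw [h1] at h
  have h2 := congrArg norm h
  rw [norm_prod] at h2
  refine Eq.trans ?_ h2
  rw [Ideal.absNorm_span_singleton, ← Algebra.coe_norm_int]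
  simp [Nat.cast_natAbs]

variable {M : Type} [AddCommGroup M] [Module (𝓞 K) M]

/-- Multiplicativity of the index along (φ s) ⊆ φ M ⊆ `𝓞 K`. -/
theorem card_quotient_span_mul {φ : M →ₗ[𝓞 K] 𝓞 K} (hφ : Function.Injective φ) (s : M) :
    Nat.card (M ⧸ Submodule.span (𝓞 K) {s}) * Ideal.absNorm (LinearMap.range φ) =
      Ideal.absNorm (Ideal.span {φ s}) := by
  have h1 : (Submodule.map φ (Submodule.span (𝓞 K) {s})) = Ideal.span {φ s} := by
    rw [Submodule.map_span, Set.image_singleton]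
  rw [← h1]
  set N := Submodule.span (𝓞 K) {s}
  have h2 := AddSubgroup.relIndex_map_map_of_injective (f := φ.toAddMonoidHom) N.toAddSubgroup ⊤ hφ
  have h3 := AddSubgroup.relIndex_mul_index
    (AddSubgroup.map_mono (f := φ.toAddMonoidHom) (le_top : N.toAddSubgroup ≤ ⊤))
  rw [h2, AddSubgroup.relIndex_top_right, ← AddMonoidHom.range_eq_map] at h3
  exact h3

/-- The chosen s drops out: log #(M/s) = log N(φ s) - log N(φ M), and log N(φ s) = ∑ log |σ(φ s)|
cancels against the same sum coming from the norms. -/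
theorem arakelovDegree_eq [Nontrivial M] {φ : M →ₗ[𝓞 K] 𝓞 K} (hφ : Function.Injective φ)
    {c : (K →+* ℂ) → ℝ} (hc : ∀ σ, 0 < c σ) {nrm : (K →+* ℂ) → M → ℝ}
    (h : ∀ σ m, nrm σ m = ‖intEmbedding σ (φ m)‖ * c σ) :
    arakelovDegree K M nrm =
      -Real.log (Ideal.absNorm (LinearMap.range φ)) - ∑ σ, Real.log (c σ) := by
  have hex : ∃ s : M, s ≠ 0 := exists_ne 0
  have hs := hex.choose_spec
  rw [arakelovDegree, dif_pos hex]
  set s := hex.choose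
  have hφs : φ s ≠ 0 := fun h => hs (hφ (h.trans (map_zero φ).symm))
  have hσ (σ : K →+* ℂ) : ‖intEmbedding σ (φ s)‖ ≠ 0 := by
    rw [norm_ne_zero_iff, map_ne_zero_iff _ (intEmbedding_injective σ)]
    exact hφs
  have h1 := congr(($(card_quotient_span_mul hφ s) : ℝ))
  push_cast at h1
  rw [absNorm_span_eq_prod] at h1
  have h2 : (∏ σ : K →+* ℂ, ‖intEmbedding σ (φ s)‖) ≠ 0 := Finset.prod_ne_zero_iff.2 fun σ _ => hσ σ
  rw [← h1] at h2
  have h3 := congr(Real.log $h1)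
  rw [Real.log_mul (left_ne_zero_of_mul h2) (right_ne_zero_of_mul h2),
    Real.log_prod fun σ _ => hσ σ] at h3
  simp_rw [h, Real.log_mul (hσ _) (hc _).ne', Finset.sum_add_distrib]
  linarith

theorem finite_multiplicity_ne_zero {R : Type*} [CommRing R] [IsDedekindDomain R] {J : Ideal R}
    (hJ : J ≠ ⊥) :
    {p : IsDedekindDomain.HeightOneSpectrum R | multiplicity p.asIdeal J ≠ 0}.Finite :=
  (Ideal.finite_factors hJ).subset fun _ hp => dvd_of_multiplicity_pos (Nat.pos_of_ne_zero hp)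

theorem finsum_multiplicity_mul_log {R : Type*} [CommRing R] [IsDedekindDomain R] [Module.Free ℤ R]
    [Module.Finite ℤ R] {J : Ideal R} (hJ : J ≠ ⊥) :
    ∑ᶠ p : IsDedekindDomain.HeightOneSpectrum R,
      (multiplicity p.asIdeal J : ℝ) * Real.log (Ideal.absNorm p.asIdeal) =
        Real.log (Ideal.absNorm J) := by
  have hfin := finite_multiplicity_ne_zero hJ
  have h1 := Ideal.finprod_heightOneSpectrum_pow_multiplicity hJ
  rw [finprod_eq_prod_of_mulSupport_subset (s := hfin.toFinset)] at h1
  · rw [finsum_eq_sum_of_support_subset (s := hfin.toFinset)]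
    · conv_rhs => rw [← h1]
      have h2 := h1.trans_ne hJ
      rw [map_prod, Nat.cast_prod, Real.log_prod]
      · simp [Real.log_pow]
      · intro p hp
        rw [Nat.cast_ne_zero, Ne, Ideal.absNorm_eq_zero_iff]
        exact Finset.prod_ne_zero_iff.1 h2 p hp
    · intro p hp
      rw [Set.Finite.coe_toFinset]
      intro h
      rw [Function.mem_support, h, Nat.cast_zero, zero_mul] at hp
      exact hp rfl
  · intro p hp
    rw [Set.Finite.coe_toFinset]
    intro h
    rw [Function.mem_mulSupport, h, pow_zero] at hp
    exact hp rfl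

end Degree

/-! ### Quotient norms on one-dimensional quotients of hermitian spaces. -/

section QuotientNorm

variable {E W : Type*} [NormedAddCommGroup E] [InnerProductSpace ℂ E] [NormedAddCommGroup W]
  [InnerProductSpace ℂ W] {n : ℕ}

/-- The quotient norm on a quotient of rank one. -/
theorem isLeast_norm_lift (u : OrthonormalBasis (Fin n) ℂ E) {ℓ : E →ₗ[ℂ] W} (hℓ : ℓ ≠ 0)
    (hW : Module.finrank ℂ W = 1) (y : W) :
    0 < ∑ i, ‖ℓ (u i)‖ ^ 2 ∧
    IsLeast {r | ∃ w, ℓ w = y ∧ r = ‖w‖} (‖y‖ / √(∑ i, ‖ℓ (u i)‖ ^ 2)) := by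
  set S := ∑ i, ‖ℓ (u i)‖ ^ 2 with hS
  have hS0 : 0 < S := by
    refine lt_of_le_of_ne (Finset.sum_nonneg fun i _ => sq_nonneg _) fun h => hℓ ?_
    refine u.toBasis.ext fun i => ?_
    have := (Finset.sum_eq_zero_iff_of_nonneg fun i _ => sq_nonneg ‖ℓ (u i)‖).1 h.symm i
      (Finset.mem_univ i)
    simpa using this
  refine ⟨hS0, ?_, ?_⟩
  · obtain ⟨i, hi⟩ : ∃ i, ℓ (u i) ≠ 0 := by
      by_contra! H
      exact hℓ (u.toBasis.ext fun i => by simpa using H i)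
    set e := ℓ (u i)
    have hspan (v : W) : ∃ t : ℂ, t • e = v := exists_smul_eq_of_finrank_eq_one hW hi v
    choose t ht using hspan
    have hen : ‖e‖ ≠ 0 := norm_ne_zero_iff.2 hi
    have hSt : S = (∑ j, ‖t (ℓ (u j))‖ ^ 2) * ‖e‖ ^ 2 := by
      rw [hS, Finset.sum_mul]
      refine Finset.sum_congr rfl fun j _ => ?_
      conv_lhs => rw [← ht (ℓ (u j)), norm_smul, mul_pow]
    set T := ∑ j, ‖t (ℓ (u j))‖ ^ 2 with hT
    have hT0 : 0 < T := by
      rw [hSt] at hS0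
      exact pos_of_mul_pos_left hS0 (sq_nonneg _)
    -- The minimal lift is orthogonal to the kernel, hence proportional to the vector with
    -- coordinates conj(t_j), where ℓ(u_j) = t_j e; the factor t(y)/T makes its image y.
    refine ⟨∑ j, (starRingEnd ℂ (t (ℓ (u j))) * (t y / T)) • u j, ?_, ?_⟩
    · rw [map_sum]
      have h1 (j : Fin n) : ℓ ((starRingEnd ℂ (t (ℓ (u j))) * (t y / T)) • u j) =
          ((‖t (ℓ (u j))‖ ^ 2 : ℝ) * (t y / T) : ℂ) • e := by
        rw [map_smul]
        nth_rewrite 2 [← ht (ℓ (u j))]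
        rw [smul_smul]
        congr 1
        push_cast
        rw [← Complex.conj_mul']
        ring
      simp_rw [h1]
      rw [← Finset.sum_smul, ← Finset.sum_mul, ← Complex.ofReal_sum, ← hT,
        mul_div_cancel₀ _ (Complex.ofReal_ne_zero.2 hT0.ne'), ht]
    · rw [eq_comm, ← sq_eq_sq₀ (norm_nonneg _) (by positivity), ← u.sum_sq_norm_inner_right]
      simp_rw [u.orthonormal.inner_right_fintype, norm_mul, mul_pow, RCLike.norm_conj]
      rw [← Finset.sum_mul, ← hT, div_pow, Real.sq_sqrt hS0.le, hSt,
        show ‖y‖ = _ from (congrArg norm (ht y)).symm.trans (norm_smul _ _), norm_div, Complex.norm_real, Real.norm_of_nonneg hT0.le]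
      field_simp
  · rintro _ ⟨w, rfl, rfl⟩
    rw [div_le_iff₀ (Real.sqrt_pos.2 hS0)]
    conv_lhs => rw [← u.sum_repr' w, map_sum]
    refine (norm_sum_le _ _).trans ?_
    simp_rw [map_smul, norm_smul]
    -- Cauchy–Schwarz, which bounds ‖ℓ(w)‖ by ‖w‖ √S for every lift w.
    refine (Real.sum_mul_le_sqrt_mul_sqrt _ _ _).trans ?_
    rw [u.sum_sq_norm_inner_right, Real.sqrt_sq (norm_nonneg _)]

end QuotientNorm

section HermitianNorm

variable {E W : Type} [AddCommGroup E] [Module ℂ E] [AddCommGroup W] [Module ℂ W]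

theorem hermNorm_smul (c : InnerProductSpace.Core ℂ W) (a : ℂ) (w : W) :
    hermNorm c (a • w) = ‖a‖ * hermNorm c w := by
  let : NormedAddCommGroup W := c.toNormedAddCommGroup
  let : InnerProductSpace ℂ W := InnerProductSpace.ofCore c.toCore
  exact norm_smul a w

theorem hermNorm_pos (c : InnerProductSpace.Core ℂ W) {w : W} (hw : w ≠ 0) : 0 < hermNorm c w := by
  let : NormedAddCommGroup W := c.toNormedAddCommGroup
  exact norm_pos_iff.2 hw

theorem sInf_hermNorm_lift (c : InnerProductSpace.Core ℂ E) (d : InnerProductSpace.Core ℂ W)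
    {n : ℕ} (u : Module.Basis (Fin n) ℂ E) (hu : ∀ i j, c.inner (u i) (u j) = if i = j then 1 else 0)
    {ℓ : E →ₗ[ℂ] W} (hℓ : ℓ ≠ 0) (hW : Module.finrank ℂ W = 1) (y : W) :
    0 < ∑ i, hermNorm d (ℓ (u i)) ^ 2 ∧
    sInf {r | ∃ w, ℓ w = y ∧ r = hermNorm c w} =
      hermNorm d y * (√(∑ i, hermNorm d (ℓ (u i)) ^ 2))⁻¹ := by
  let : NormedAddCommGroup E := c.toNormedAddCommGroup
  let : InnerProductSpace ℂ E := InnerProductSpace.ofCore c.toCore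
  let : NormedAddCommGroup W := d.toNormedAddCommGroup
  let : InnerProductSpace ℂ W := InnerProductSpace.ofCore d.toCore
  have ho : Orthonormal ℂ u := orthonormal_iff_ite.2 hu
  obtain ⟨h1, h2⟩ := isLeast_norm_lift (u.toOrthonormalBasis ho) hℓ hW y
  rw [u.coe_toOrthonormalBasis] at h1 h2
  exact ⟨h1, h2.csInf_eq⟩

end HermitianNorm

/-! ### Complexification and the quotient norm of a rank one quotient. -/

section Complexification

variable {K : Type} [Field K] {σ : K →+* ℂ} {M N W : Type} [AddCommGroup M]
  [Module (𝓞 K) M] [AddCommGroup N] [Module (𝓞 K) N] [AddCommGroup W] [Module ℂ W]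

theorem complexifyMap_toComplexification (f : M →ₗ[𝓞 K] N) (m : M) :
    complexifyMap σ f (toComplexification σ m) = toComplexification σ (f m) := rfl

theorem span_range_toComplexification :
    Submodule.span ℂ (Set.range (toComplexification σ (M := M))) = ⊤ := by
  let : Algebra (𝓞 K) ℂ := (intEmbedding σ).toAlgebra
  have h : Submodule.span ℂ (Set.range (TensorProduct.mk (𝓞 K) ℂ M 1)) = ⊤ := by
    rw [← LinearMap.coe_range, LinearMap.range_eq_map, ← Submodule.baseChange_eq_span,
      Submodule.baseChange_top]
  exact h

theorem complexification_hom_ext {f f' : Complexification σ M →ₗ[ℂ] W}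
    (h : ∀ m, f (toComplexification σ m) = f' (toComplexification σ m)) : f = f' :=
  LinearMap.ext_on_range span_range_toComplexification h

theorem toComplexification_smul (a : 𝓞 K) (m : M) :
    toComplexification σ (a • m) = intEmbedding σ a • toComplexification σ m := by
  let : Algebra (𝓞 K) ℂ := (intEmbedding σ).toAlgebra
  have h : (1 : ℂ) ⊗ₜ[𝓞 K] (a • m) = algebraMap (𝓞 K) ℂ a • ((1 : ℂ) ⊗ₜ[𝓞 K] m) := by
    rw [TensorProduct.tmul_smul, algebraMap_smul]
  exact h

/-- The linear map on `M_σ` induced by a semilinear map on `M`. -/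
def complexLift (r : M →ₛₗ[intEmbedding σ] W) : Complexification σ M →ₗ[ℂ] W :=
  letI : Algebra (𝓞 K) ℂ := (intEmbedding σ).toAlgebra
  letI : Module (𝓞 K) W := Module.compHom _ (algebraMap (𝓞 K) ℂ)
  haveI : IsScalarTower (𝓞 K) ℂ W := IsScalarTower.of_algebraMap_smul fun _ _ => rfl
  LinearMap.liftBaseChange ℂ
    { toFun := r
      map_add' := r.map_add
      map_smul' := r.map_smulₛₗ }

theorem complexLift_toComplexification (r : M →ₛₗ[intEmbedding σ] W) (m : M) :
    complexLift r (toComplexification σ m) = r m := by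
  let : Algebra (𝓞 K) ℂ := (intEmbedding σ).toAlgebra
  let : Module (𝓞 K) W := Module.compHom _ (algebraMap (𝓞 K) ℂ)
  have : IsScalarTower (𝓞 K) ℂ W := IsScalarTower.of_algebraMap_smul fun _ _ => rfl
  exact (LinearMap.liftBaseChange_tmul ..).trans (one_smul ℂ _)

/-- Rank one makes M_σ the span of 1 ⊗ m₀, whose image r(m₀) is nonzero. -/
theorem complexLift_injective {r : M →ₛₗ[intEmbedding σ] W} {m₀ : M} (h₀ : r m₀ ≠ 0)
    (hrk : ∀ m : M, ∃ a b : 𝓞 K, a ≠ 0 ∧ a • m = b • m₀) :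
    Function.Injective (complexLift r) := by
  have h (z : Complexification σ M) : ∃ t : ℂ, z = t • toComplexification σ m₀ := by
    have hz : z ∈ Submodule.span ℂ {toComplexification σ m₀} := by
      refine (Submodule.span_le.2 ?_ : Submodule.span ℂ (Set.range (toComplexification σ (M := M))) ≤ _)
        (by rw [span_range_toComplexification]; trivial)
      rintro _ ⟨m, rfl⟩
      obtain ⟨a, b, ha, hab⟩ := hrk m
      have ha' : intEmbedding σ a ≠ 0 := (map_ne_zero_iff _ (intEmbedding_injective σ)).2 ha
      have h1 := congrArg (toComplexification σ) hab
      rw [toComplexification_smul, toComplexification_smul] at h1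
      rw [← inv_smul_smul₀ ha' (toComplexification σ m), h1]
      exact Submodule.smul_mem _ _ (Submodule.smul_mem _ _ (Submodule.mem_span_singleton_self _))
    obtain ⟨t, ht⟩ := Submodule.mem_span_singleton.1 hz
    exact ⟨t, ht.symm⟩
  rw [injective_iff_map_eq_zero]
  intro z hz
  obtain ⟨t, rfl⟩ := h z
  rw [map_smul, complexLift_toComplexification, smul_eq_zero_iff_left h₀] at hz
  rw [hz, zero_smul]

/-- By injectivity of `complexLift r`, lifting v to F_σ is the same as solving ℓ(w) = r(v), so the
infimum is the one for the line W. -/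
theorem quotientNorm_eq {F : Type} [AddCommGroup F] [Module (𝓞 K) F] {N : Submodule (𝓞 K) F}
    {r : F ⧸ N →ₛₗ[intEmbedding σ] W} {v₀ : F ⧸ N} (h₀ : r v₀ ≠ 0)
    (hrk : ∀ v, ∃ a b : 𝓞 K, a ≠ 0 ∧ a • v = b • v₀) {ℓ : Complexification σ F →ₗ[ℂ] W}
    (hℓ : ∀ s, ℓ (toComplexification σ s) = r (N.mkQ s)) (hW : Module.finrank ℂ W = 1)
    (h : HermitianStructure K F) (d : InnerProductSpace.Core ℂ W) {n : ℕ}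
    (u : Module.Basis (Fin n) ℂ (Complexification σ F))
    (hu : ∀ i j, (h σ).inner (u i) (u j) = if i = j then 1 else 0) (v : F ⧸ N) :
    0 < ∑ i, hermNorm d (ℓ (u i)) ^ 2 ∧ quotientNorm F h N σ v =
      hermNorm d (r v) * (√(∑ i, hermNorm d (ℓ (u i)) ^ 2))⁻¹ := by
  have h1 : ℓ = complexLift r ∘ₗ complexifyMap σ N.mkQ := complexification_hom_ext fun s => by
    rw [hℓ, LinearMap.comp_apply, complexifyMap_toComplexification, complexLift_toComplexification]
  have h2 (w : Complexification σ F) :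
      complexifyMap σ N.mkQ w = toComplexification σ v ↔ ℓ w = r v := by
    rw [← (complexLift_injective h₀ hrk).eq_iff, complexLift_toComplexification, h1]; rfl
  have hℓ0 : ℓ ≠ 0 := by
    rintro rfl
    obtain ⟨s, rfl⟩ := N.mkQ_surjective v₀
    exact h₀ (hℓ s).symm
  simp_rw [quotientNorm, h2]
  exact sInf_hermNorm_lift (h σ) d u hu hℓ0 hW (r v)

end Complexification

/-! ### Comparison of the two degrees. -/

section Comparison

variable {K : Type} [Field K] [NumberField K] {F M : Type} [AddCommGroup F] [Module (𝓞 K) F]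
  [AddCommGroup M] [Module (𝓞 K) M] [Module.Finite (𝓞 K) M] {W : (K →+* ℂ) → Type}
  [∀ σ, AddCommGroup (W σ)] [∀ σ, Module ℂ (W σ)]

theorem range_comp_smul_top {R V N : Type*} [CommRing R] [AddCommGroup V] [Module R V]
    [AddCommGroup N] [Module R N] {J : Ideal R} {f : V →ₗ[R] N}
    (hf : LinearMap.range f = J • (⊤ : Submodule R N)) (φ : N →ₗ[R] R) :
    LinearMap.range (φ ∘ₗ f) = J * LinearMap.range φ := by
  rw [LinearMap.range_comp, hf, Submodule.map_smul'', ← LinearMap.range_eq_map]; rfl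

/-- The comparison of the degree of a line bundle on `Spec (𝓞 K)` with the degree of the quotient of
`F` defined by a homomorphism from `F` to it, with the quotient norms. -/
theorem arakelovDegree_eq_add (htf : ∀ (a : 𝓞 K) (m : M), a • m = 0 → a = 0 ∨ m = 0)
    (hrk : ∀ m₀ : M, m₀ ≠ 0 → ∀ m : M, ∃ a b : 𝓞 K, a ≠ 0 ∧ a • m = b • m₀) {ev : F →ₗ[𝓞 K] M}
    (hev : ev ≠ 0) {J : Ideal (𝓞 K)} (hJ : J ≠ ⊥)
    (hrange : LinearMap.range ev = J • (⊤ : Submodule (𝓞 K) M))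
    {N : Submodule (𝓞 K) F} (hN : N = LinearMap.ker ev)
    (r : ∀ σ : K →+* ℂ, M →ₛₗ[intEmbedding σ] W σ) (hr : ∀ σ m, m ≠ 0 → r σ m ≠ 0)
    (hW : ∀ σ, Module.finrank ℂ (W σ) = 1) (d : ∀ σ, InnerProductSpace.Core ℂ (W σ))
    (ℓ : ∀ σ, Complexification σ F →ₗ[ℂ] W σ)
    (hℓ : ∀ σ s, ℓ σ (toComplexification σ s) = r σ (ev s)) (h : HermitianStructure K F) {n : ℕ}
    (u : ∀ σ : K →+* ℂ, Module.Basis (Fin n) ℂ (Complexification σ F))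
    (hu : ∀ σ i j, (h σ).inner (u σ i) (u σ j) = if i = j then 1 else 0) :
    arakelovDegree K M (fun σ m => hermNorm (d σ) (r σ m)) =
      arakelovDegree K (F ⧸ N) (quotientNorm F h N) + (Real.log (Ideal.absNorm J) +
        ∑ σ, -(1 / 2) * Real.log (∑ i, hermNorm (d σ) (ℓ σ (u σ i)) ^ 2)) := by
  subst hN
  obtain ⟨s₀, hs₀⟩ : ∃ s, ev s ≠ 0 := by
    by_contra! H
    exact hev (LinearMap.ext H)
  set m₀ := ev s₀
  obtain ⟨φ, hφ⟩ := exists_injective_linearMap htf hs₀ (hrk m₀ hs₀)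
  have hφ₀ (σ : K →+* ℂ) : intEmbedding σ (φ m₀) ≠ 0 := by
    rw [map_ne_zero_iff _ (intEmbedding_injective σ), map_ne_zero_iff _ hφ]
    exact hs₀
  -- The constant by which the norm of M at σ differs from the absolute value of σ ∘ φ, read off at
  -- m₀; as φ(m₀) m = φ(m) m₀, it serves for all m.
  set c : (K →+* ℂ) → ℝ := fun σ => hermNorm (d σ) (r σ m₀) / ‖intEmbedding σ (φ m₀)‖ with hc
  have hc0 (σ) : 0 < c σ := div_pos (hermNorm_pos _ (hr σ _ hs₀)) (norm_pos_iff.2 (hφ₀ σ))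
  have hnorm (σ : K →+* ℂ) (m : M) :
      hermNorm (d σ) (r σ m) = ‖intEmbedding σ (φ m)‖ * c σ := by
    have h1 : φ m₀ • m = φ m • m₀ := hφ (by simp [mul_comm])
    have h2 := congr(hermNorm (d σ) (r σ $h1))
    rw [map_smulₛₗ, map_smulₛₗ, hermNorm_smul, hermNorm_smul] at h2
    rw [hc, mul_div_assoc', eq_div_iff (norm_ne_zero_iff.2 (hφ₀ σ)), ← h2, mul_comm]
  set f := (LinearMap.ker ev).liftQ ev le_rfl with hf
  have hfinj : Function.Injective f := LinearMap.ker_eq_bot.1 (Submodule.ker_liftQ_eq_bot _ _ _ le_rfl)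
  have hfrange : LinearMap.range f = J • (⊤ : Submodule (𝓞 K) M) := by
    rw [hf, Submodule.range_liftQ, hrange]
  have hv₀ : (LinearMap.ker ev).mkQ s₀ ≠ 0 := by
    intro H
    exact hs₀ (congr(f $H).trans (map_zero f))
  have : Nontrivial (F ⧸ LinearMap.ker ev) := ⟨_, _, hv₀⟩
  have : Nontrivial M := ⟨_, _, hs₀⟩
  have hq (σ : K →+* ℂ) (v : F ⧸ LinearMap.ker ev) := quotientNorm_eq (r := (r σ).comp f)
    (v₀ := (LinearMap.ker ev).mkQ s₀) (hr σ _ hs₀) (fun v => by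
      obtain ⟨a, b, ha, hab⟩ := hrk m₀ hs₀ (f v)
      refine ⟨a, b, ha, hfinj ?_⟩
      rw [map_smul, map_smul, hab]
      rfl) (hℓ σ) (hW σ) h (d σ) (u σ) (hu σ) v
  have hS (σ : K →+* ℂ) := (hq σ 0).1
  -- The quotient F/ker ev is embedded in `𝓞 K` by the same φ composed with f. Its image is J · φ M
  -- and its norm constants are c_σ/√S_σ, so the degrees differ by log N(J) - ½ ∑ log S_σ.
  rw [arakelovDegree_eq hφ hc0 hnorm, arakelovDegree_eq (φ := φ ∘ₗ f) (hφ.comp hfinj)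
    (c := fun σ => c σ * (√(∑ i, hermNorm (d σ) (ℓ σ (u σ i)) ^ 2))⁻¹)
    (fun σ => mul_pos (hc0 σ) (inv_pos.2 (Real.sqrt_pos.2 (hS σ))))
    (fun σ v => (hq σ v).2.trans (by rw [← mul_assoc]; exact congrArg (· * _) (hnorm σ (f v)))),
    range_comp_smul_top hfrange, map_mul, Nat.cast_mul, Real.log_mul]
  · have (σ : K →+* ℂ) : Real.log (c σ * (√(∑ i, hermNorm (d σ) (ℓ σ (u σ i)) ^ 2))⁻¹) =
        Real.log (c σ) + -(1 / 2) * Real.log (∑ i, hermNorm (d σ) (ℓ σ (u σ i)) ^ 2) := by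
      rw [Real.log_mul (hc0 σ).ne' (inv_pos.2 (Real.sqrt_pos.2 (hS σ))).ne', Real.log_inv,
        Real.log_sqrt (hS σ).le]
      ring
    simp_rw [this, Finset.sum_add_distrib]
    ring
  · rw [Nat.cast_ne_zero, Ne, Ideal.absNorm_eq_zero_iff]
    exact hJ
  · rw [Nat.cast_ne_zero, Ne, Ideal.absNorm_eq_zero_iff]
    intro H
    rw [LinearMap.range_eq_bot] at H
    exact hs₀ (hφ (by rw [H]; rfl))

end Comparison

/-! ### The point of the projective bundle defined by P_K. -/

section GenericPoint

/-- The one-dimensional quotient of a vector space that a nonzero linear map to a line defines. -/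
theorem exists_grassmannian_eq_ker {k V W : Type} [Field k] [AddCommGroup V] [Module k V]
    [AddCommGroup W] [Module k W] (hW : Module.finrank k W = 1) {ℓ : V →ₗ[k] W} (hℓ : ℓ ≠ 0) :
    ∃ Q : G(1, V; k), Q.toSubmodule = LinearMap.ker ℓ := by
  have e : (V ⧸ LinearMap.ker ℓ) ≃ₗ[k] W :=
    ℓ.quotKerEquivOfSurjective (surjective_of_nonzero_of_finrank_eq_one hW hℓ)
  have : Module.Finite k W := Module.finite_of_finrank_eq_succ hW
  have : Module.Finite k (V ⧸ LinearMap.ker ℓ) := Module.Finite.equiv e.symm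
  exact ⟨⟨LinearMap.ker ℓ, inferInstance, inferInstance, fun p => by
    rw [Module.rankAtStalk_eq_finrank_of_free, e.finrank_eq, hW]; rfl⟩, rfl⟩

variable {K : Type} [Field K] {X : Scheme.{0}} (π : X ⟶ Spec (.of (𝓞 K)))
  {L : X.Modules} (F : Submodule (𝓞 K) (DirectImage π L)) {P : Spec (.of (𝓞 K)) ⟶ X}
  (hP : P ≫ π = 𝟙 _)

theorem genericEvaluation_tmul (a : K) (s : F) : genericEvaluation π L F P hP (a ⊗ₜ s) =
    a • restriction L P (algebraMap (𝓞 K) K) (sectionEvaluation π F P hP s) :=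
  evaluation_tmul_eq_restriction π F hP _ a s

theorem complexEvaluation_toComplexification (σ : K →+* ℂ) (s : F) :
    complexEvaluation π L F P hP σ (toComplexification σ s) =
      restriction L P (intEmbedding σ) (sectionEvaluation π F P hP s) := by
  let : Algebra (𝓞 K) ℂ := (intEmbedding σ).toAlgebra
  exact (evaluation_tmul_eq_restriction π F hP _ 1 s).trans (one_smul _ _)

/-- A nonzero element of P^*L stays nonzero at P_K, so vanishing of s at P_K is the same as
vanishing of P^*s. -/
theorem latticeKernel_ker_genericEvaluation [NumberField K] (hL : IsLineBundle L) :
    latticeKernel F (LinearMap.ker (genericEvaluation π L F P hP)) =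
      LinearMap.ker (sectionEvaluation π F P hP) := by
  ext s
  have h : s ∈ latticeKernel F (LinearMap.ker (genericEvaluation π L F P hP)) ↔
    genericEvaluation π L F P hP (1 ⊗ₜ s) = 0 := Iff.rfl
  rw [h, genericEvaluation_tmul, one_smul, LinearMap.mem_ker]
  constructor
  · intro h0
    by_contra H
    exact hL.locallyGenerated.restrictFibre_ne_zero P
      (FaithfulSMul.algebraMap_injective (𝓞 K) K) H h0
  · intro h0
    rw [h0, map_zero]

theorem genericEvaluation_ne_zero [NumberField K] (hL : IsLineBundle L) (h : sectionEvaluation π F P hP ≠ 0) :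
    genericEvaluation π L F P hP ≠ 0 := by
  intro h0
  refine h (LinearMap.ker_eq_top.1 ?_)
  rw [← latticeKernel_ker_genericEvaluation π F hP hL, h0, LinearMap.ker_zero]
  rfl

end GenericPoint

end ArakelovHeight

end

/-! ### The height formula. -/

theorem mainTheorem8 {K : Type} [Field K] [NumberField K] {X : Scheme.{0}} [IsIntegral X]
    (π : X ⟶ Spec (.of (𝓞 K))) [Flat π] (hqp : ArakelovHeight.IsQuasiProjective π)
    (hsm : Smooth (Limits.pullback.snd π
      (Spec.map (CommRingCat.ofHom (algebraMap (𝓞 K) K)))))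
    (L : X.Modules) (hL : ArakelovHeight.IsLineBundle L) (g : ArakelovHeight.HermitianMetric L)
    (F : Submodule (𝓞 K) (ArakelovHeight.DirectImage π L))
    [Module.Finite (𝓞 K) F] [Module.Projective (𝓞 K) F]
    (h : ArakelovHeight.HermitianStructure K F)
    (hgen : ∀ x : X, (π x).asIdeal = ⊥ → ArakelovHeight.GeneratesAt π L F x)
    (P : Spec (.of (𝓞 K)) ⟶ X) (hP : P ≫ π = 𝟙 _) :
    (∀ U : X.affineOpens,
      (ArakelovHeight.baseIdeal π L F).ideal U • (⊤ : Submodule Γ(X, U) Γ(L, U)) =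
        ArakelovHeight.generatedSections π L F U) ∧
    ArakelovHeight.pullbackIdeal (ArakelovHeight.baseIdeal π L F) P ≠ ⊥ ∧
    {p | ArakelovHeight.finiteMultiplicity π L F P p ≠ 0}.Finite ∧
    ∃ Q : G(1, K ⊗[𝓞 K] F; K),
      Q.toSubmodule = LinearMap.ker (ArakelovHeight.genericEvaluation π L F P hP) ∧
      ∀ (n : ℕ) (u : ∀ σ : K →+* ℂ, Module.Basis (Fin n) ℂ (ArakelovHeight.Complexification σ F)),
        (∀ σ i j, (h σ).inner (u σ i) (u σ j) = if i = j then 1 else 0) →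
        ArakelovHeight.sectionHeight L g P =
          ArakelovHeight.projectiveHeight F h Q +
            (Module.finrank ℚ K : ℝ)⁻¹ *
              ((∑ᶠ p : IsDedekindDomain.HeightOneSpectrum (𝓞 K),
                  (ArakelovHeight.finiteMultiplicity π L F P p : ℝ) *
                    Real.log (Ideal.absNorm p.asIdeal)) +
                ∑ σ : K →+* ℂ, ArakelovHeight.archimedeanTerm π L g F P hP σ (u σ)) := by
  have hev := ArakelovHeight.sectionEvaluation_ne_zero π F P hP hL hgen
  have hJ := ArakelovHeight.pullbackIdeal_baseIdeal_ne_bot π F P hP hL hgen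
  have hlg := hL.locallyGenerated
  obtain ⟨Q, hQ⟩ := ArakelovHeight.exists_grassmannian_eq_ker (hlg.finrank_fibre _)
    (ArakelovHeight.genericEvaluation_ne_zero π F hP hL hev)
  refine ⟨ArakelovHeight.baseIdeal_smul_top π F hlg, hJ,
    ArakelovHeight.finite_multiplicity_ne_zero hJ, Q, hQ, fun n u hu => ?_⟩
  have : Module.Finite (𝓞 K) (ArakelovHeight.Fibre L P) :=
    (hlg.pullback P).finite_globalSections
  -- The fibre of O(1) at the integral extension of Q is F/ker ev, which allows
  -- `arakelovDegree_eq_add` to be applied.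
  have hN : (ArakelovHeight.integralPoint F Q).toSubmodule =
      LinearMap.ker (ArakelovHeight.sectionEvaluation π F P hP) := by
    rw [← ArakelovHeight.latticeKernel_ker_genericEvaluation π F hP hL, ← hQ]
    rfl
  rw [ArakelovHeight.sectionHeight, ArakelovHeight.projectiveHeight, ← mul_add]
  congr 1
  refine (ArakelovHeight.arakelovDegree_eq_add
    (fun a m => (hlg.pullback P).globalSections_smul_eq_zero)
    (fun m₀ h₀ => (hlg.pullback P).globalSections_exists_smul_eq_smul h₀) hev hJ
    (ArakelovHeight.range_sectionEvaluation π F P hP hL) hN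
    (fun σ => ArakelovHeight.restriction L P (ArakelovHeight.intEmbedding σ))
    (fun σ m => hlg.restrictFibre_ne_zero P (ArakelovHeight.intEmbedding_injective σ))
    (fun σ => hlg.finrank_fibre _) (fun σ => g.inner (ArakelovHeight.complexPoint P σ))
    (fun σ => ArakelovHeight.complexEvaluation π L F P hP σ)
    (fun σ => ArakelovHeight.complexEvaluation_toComplexification π F hP σ) h u hu).trans ?_
  rw [← ArakelovHeight.finsum_multiplicity_mul_log hJ]
  rfl
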